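/- For an integer $m\ge 3$ put $a_m=\frac{4(m-1)}{m-2}$ and $p_m=\frac{2m}{m-2}$. For a non-empty smooth Riemannian manifold $(M,G)$ of dimension $m\ge 3$ (without boundary, Hausdorff and second countable, not necessarily compact, complete or connected), with scalar curvature $s^G$ and Riemannian volume $dv^G$, the conformal Yamabe constant is $$\mu(M,G)=\inf_{u\in C_c^\infty(M),\,u\not\equiv 0}\ \frac{\int_M\left(a_m|du|_G^2+s^G u^2\right)dv^G}{\left(\int_M|u|^{p_m}\,dv^G\right)^{2/p_m}}\in[-\infty,\infty),$$ where $C_c^\infty(M)$ denotes the real-valued smooth functions with compact support; if $\mu(M,G)\ge 0$, put $\nu(M,G)=\left(\frac{\mu(M,G)}{m\,a_m}\right)^m$. **Theorem.** Let $(V,g)$ and $(W,h)$ be two such Riemannian manifolds, of dimensions $v,w\ge 3$, and let $m=v+w$, $M=V\times W$ and $G=g+h$ (the product metric). Assume that $\mu(V,g)\ge 0$, $\mu(W,h)\ge 0$ and that $$\frac{s^g(x)+s^h(y)}{a_m}\ \ge\ \frac{s^g(x)}{a_v}+\frac{s^h(y)}{a_w}\qquad\text{for all }x\in V,\ y\in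 W.$$ Then $$\mu(M,G)\ \ge\ \frac{m\,a_m}{(v\,a_v)^{v/m}\,(w\,a_w)^{w/m}}\ \mu(V,g)^{v/m}\,\mu(W,h)^{w/m},$$ or, equivalently, $\nu(M,G)\ge\nu(V,g)\,\nu(W,h)$. -/

import Mathlib

open scoped ContDiff Manifold Topology
open MeasureTheory Bundle

namespace Yamabe

noncomputable section

/-! ## Curvature of a metric on (an open subset of) a finite-dimensional real vector space

Here `b : E → E →L[ℝ] E →L[ℝ] ℝ` is a field of bilinear forms, to be thought of as a smooth
Riemannian metric near the point `y` at which the objects are evaluated. Note that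
`(b y).inverse : (E →L[ℝ] ℝ) →L[ℝ] E` is the musical isomorphism raising an index. -/

section Local

variable {E : Type*} [NormedAddCommGroup E] [NormedSpace ℝ E]

/-- The Christoffel symbol `Γ_y(v, w)`: the vector such that, for all `u`,
`b_y(Γ_y(v, w), u) = ½ (∂_v b(w, u) + ∂_w b(v, u) - ∂_u b(v, w))`. -/
def christoffel (b : E → E →L[ℝ] E →L[ℝ] ℝ) (y v w : E) : E :=
  (b y).inverse ((1 / 2 : ℝ) •
    (fderiv ℝ b y v w + fderiv ℝ b y w v - ((fderiv ℝ b y).flip v).flip w))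

/-- The Riemann curvature tensor `R(u, v) w = ∇_u ∇_v w - ∇_v ∇_u w` for constant vector
fields `u`, `v`, `w`, where `∇_v w = Γ(v, w)`. -/
def curvatureTensor (b : E → E →L[ℝ] E →L[ℝ] ℝ) (y u v w : E) : E :=
  fderiv ℝ (fun z ↦ christoffel b z v w) y u - fderiv ℝ (fun z ↦ christoffel b z u w) y v
    + christoffel b y u (christoffel b y v w) - christoffel b y v (christoffel b y u w)

variable [FiniteDimensional ℝ E]

/-- The coordinate functionals of a fixed basis of `E`. -/
def coordCLM (i : Fin (Module.finrank ℝ E)) : E →L[ℝ] ℝ :=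
  LinearMap.toContinuousLinearMap ((Module.finBasis ℝ E).coord i)

/-- The Ricci tensor, `Ric(v, w) = trace (u ↦ R(u, v) w)`. -/
def ricciTensor (b : E → E →L[ℝ] E →L[ℝ] ℝ) (y v w : E) : ℝ :=
  ∑ i, coordCLM i (curvatureTensor b y (Module.finBasis ℝ E i) v w)

/-- The scalar curvature at `y` of the metric `b`: the trace of the Ricci tensor with respect to
the metric, `∑ i, Ric(e_i, (e^i)^♯)`. -/
def scalarCurvatureAt (b : E → E →L[ℝ] E →L[ℝ] ℝ) (y : E) : ℝ :=
  ∑ i, ricciTensor b y (Module.finBasis ℝ E i) ((b y).inverse (coordCLM i))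

end Local

/-! ## Riemannian metrics and their products -/

section Metric

variable {E : Type*} [NormedAddCommGroup E] [NormedSpace ℝ E]
  {H : Type*} [TopologicalSpace H] {I : ModelWithCorners ℝ E H}
  {M : Type*} [TopologicalSpace M] [ChartedSpace H M] [IsManifold I ∞ M]
  {E' : Type*} [NormedAddCommGroup E'] [NormedSpace ℝ E']
  {H' : Type*} [TopologicalSpace H'] {I' : ModelWithCorners ℝ E' H'}
  {M' : Type*} [TopologicalSpace M'] [ChartedSpace H' M'] [IsManifold I' ∞ M']

variable (I M) in
/-- Smooth Riemannian metrics on the manifold `M`. -/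
abbrev SmoothMetric := ContMDiffRiemannianMetric I ∞ E (fun x : M ↦ TangentSpace I x)

/-- The pullback `f^* g` of a Riemannian metric, as a field of bilinear forms. -/
def pullbackForm (f : M → M') (g : SmoothMetric I' M') (x : M) :
    TangentSpace I x →L[ℝ] TangentSpace I x →L[ℝ] ℝ :=
  ((mfderiv I I' f x).precomp ℝ) ∘L (g.inner (f x)) ∘L (mfderiv I I' f x)

set_option linter.unusedSectionVars false in
theorem pullbackForm_apply (f : M → M') (g : SmoothMetric I' M') (x : M) (v w : TangentSpace I x) :
    pullbackForm f g x v w = g.inner (f x) (mfderiv I I' f x v) (mfderiv I I' f x w) := rfl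

set_option synthInstance.maxHeartbeats 400000 in
set_option maxHeartbeats 1000000 in
theorem contMDiff_pullbackForm {f : M → M'} (hf : ContMDiff I I' ∞ f) (g : SmoothMetric I' M') :
    ContMDiff I (I.prod 𝓘(ℝ, E →L[ℝ] E →L[ℝ] ℝ)) ∞ (fun x ↦
      TotalSpace.mk' (E →L[ℝ] E →L[ℝ] ℝ)
        (E := fun x : M ↦ TangentSpace I x →L[ℝ] TangentSpace I x →L[ℝ] ℝ)
        x (pullbackForm f g x)) := by
  intro x₀
  have h1 : ContMDiffAt I 𝓘(ℝ, E →L[ℝ] E') ∞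
      (inTangentCoordinates I I' id f (mfderiv I I' f) x₀) x₀ :=
    hf.contMDiffAt.mfderiv_const (by simp)
  have h2 := ((contMDiffAt_hom_bundle _).1 (g.contMDiff (f x₀))).2
  have h3 := h2.comp x₀ hf.contMDiffAt
  rw [contMDiffAt_hom_bundle]
  refine ⟨contMDiffAt_id, ?_⟩
  refine ((h1.clm_precomp (F₃ := ℝ)).clm_comp (h3.clm_comp h1)).congr_of_eventuallyEq ?_
  have m1 : ∀ᶠ x in 𝓝 x₀, x ∈ (trivializationAt E (TangentSpace I) x₀).baseSet :=
    (trivializationAt E (TangentSpace I) x₀).open_baseSet.mem_nhds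
      (FiberBundle.mem_baseSet_trivializationAt' x₀)
  have m2 : ∀ᶠ x in 𝓝 x₀, f x ∈ (trivializationAt E' (TangentSpace I') (f x₀)).baseSet :=
    hf.continuous.continuousAt <|
      (trivializationAt E' (TangentSpace I') (f x₀)).open_baseSet.mem_nhds
        (FiberBundle.mem_baseSet_trivializationAt' (f x₀))
  filter_upwards [m1, m2] with x hx1 hx2
  ext v w
  have hA (v : E) : (trivializationAt E' (TangentSpace I') (f x₀)).symm (f x)
      (inTangentCoordinates I I' id f (mfderiv I I' f) x₀ x v) =
      mfderiv I I' f x ((trivializationAt E (TangentSpace I) x₀).symm x v) := by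
    have e1 : inTangentCoordinates I I' id f (mfderiv I I' f) x₀ x v =
        (trivializationAt E' (TangentSpace I') (f x₀)).continuousLinearMapAt ℝ (f x)
          (mfderiv I I' f x ((trivializationAt E (TangentSpace I) x₀).symmL ℝ x v)) := rfl
    rw [e1, Trivialization.symmL_apply _ hx1]
    rw [← Trivialization.symmL_apply (R := ℝ) _ hx2]
    exact Trivialization.symmL_continuousLinearMapAt (R := ℝ) _ hx2 _
  refine (inCoordinates_apply_eq₂ hx1 hx1 (Set.mem_univ _)).trans ?_
  refine Eq.trans ?_ (inCoordinates_apply_eq₂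
    (v := inTangentCoordinates I I' id f (mfderiv I I' f) x₀ x v)
    (w := inTangentCoordinates I I' id f (mfderiv I I' f) x₀ x w) hx2 hx2 (Set.mem_univ _)).symm
  rw [hA, hA]
  rfl

theorem prodForm_apply (g : SmoothMetric I M) (h : SmoothMetric I' M') (p : M × M')
    (v w : TangentSpace (I.prod I') p) :
    (pullbackForm Prod.fst g p + pullbackForm Prod.snd h p :
      TangentSpace (I.prod I') p →L[ℝ] TangentSpace (I.prod I') p →L[ℝ] ℝ) v w =
      g.inner p.1 v.1 w.1 + h.inner p.2 v.2 w.2 := by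
  change pullbackForm Prod.fst g p v w + pullbackForm Prod.snd h p v w = _
  rw [pullbackForm_apply, pullbackForm_apply, mfderiv_fst, mfderiv_snd]
  rfl

theorem metric_self_nonneg (g : SmoothMetric I M) (p : M) (a : TangentSpace I p) :
    0 ≤ g.inner p a a := by
  rcases eq_or_ne a 0 with rfl | ha
  · simp
  · exact (g.pos _ _ ha).le

set_option synthInstance.maxHeartbeats 400000 in
/-- The product metric `g + h` on `M × M'`: the sum of the pullbacks of `g` and `h` under the two
projections. By `prodForm_apply` it is `g(v₁, w₁) + h(v₂, w₂)` on `T(M × M') = TM × TM'`. -/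
def prodMetric (g : SmoothMetric I M) (h : SmoothMetric I' M') :
    SmoothMetric (I.prod I') (M × M') where
  inner p := pullbackForm Prod.fst g p + pullbackForm Prod.snd h p
  symm p v w := by
    rw [prodForm_apply, prodForm_apply]
    exact congrArg₂ (· + ·) (g.symm _ _ _) (h.symm _ _ _)
  pos p v hv := by
    rw [prodForm_apply]
    by_cases h1 : v.1 = 0
    · have h2 : v.2 ≠ 0 := fun h2 ↦ hv (Prod.ext h1 h2)
      exact add_pos_of_nonneg_of_pos (metric_self_nonneg g _ _) (h.pos p.2 v.2 h2)
    · exact add_pos_of_pos_of_nonneg (g.pos p.1 v.1 h1) (metric_self_nonneg h _ _)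
  isVonNBounded p := by
    have hg := (g.isVonNBounded p.1).image (ContinuousLinearMap.inl ℝ E E')
    have hh := (h.isVonNBounded p.2).image (ContinuousLinearMap.inr ℝ E E')
    refine (hg.add hh).subset fun v hv ↦ ?_
    have hv' : g.inner p.1 v.1 v.1 + h.inner p.2 v.2 v.2 < 1 := by
      have := prodForm_apply g h p v v
      exact this ▸ hv
    have h1 := metric_self_nonneg g p.1 v.1
    have h2 := metric_self_nonneg h p.2 v.2
    have g1 : g.inner p.1 v.1 v.1 < 1 := by linarith
    have g2 : h.inner p.2 v.2 v.2 < 1 := by linarith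
    exact Set.mem_add.2 ⟨((v.1 : E), (0 : E')), ⟨v.1, g1, rfl⟩,
      ((0 : E), (v.2 : E')), ⟨v.2, g2, rfl⟩,
      Prod.ext (add_zero (v.1 : E)) (zero_add (v.2 : E'))⟩
  contMDiff :=
    (contMDiff_pullbackForm contMDiff_fst g).add_section (contMDiff_pullbackForm contMDiff_snd h)

end Metric

/-! ## Scalar curvature, norm of the differential, volume and Yamabe constant

The definitions are meant for manifolds without boundary. -/

section Manifold

variable {E : Type*} [NormedAddCommGroup E] [NormedSpace ℝ E] [FiniteDimensional ℝ E]
  {H : Type*} [TopologicalSpace H] {I : ModelWithCorners ℝ E H}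
  {M : Type*} [TopologicalSpace M] [ChartedSpace H M] [IsManifold I ∞ M]

/-- The metric `g` in the chart around `x₀`, that is `g_{ij}(y)` as a bilinear form on `E`, for
`y` in the target of the chart. -/
def metricInChart (g : SmoothMetric I M) (x₀ : M) (y : E) : E →L[ℝ] E →L[ℝ] ℝ :=
  let p : M := (extChartAt I x₀).symm y
  let A : E →L[ℝ] TangentSpace I p := mfderiv 𝓘(ℝ, E) I (extChartAt I x₀).symm y
  (A.precomp ℝ) ∘L (g.inner p) ∘L A

/-- The scalar curvature `s^g` at `x`, computed in the chart around `x`. -/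
def scalarCurvature (g : SmoothMetric I M) (x : M) : ℝ :=
  scalarCurvatureAt (metricInChart g x) (extChartAt I x x)

/-- The squared norm `|du|_g²` of the differential of `u` at `x`, that is `du(grad u)`. -/
def normSqDiff (g : SmoothMetric I M) (u : M → ℝ) (x : M) : ℝ :=
  mvfderiv I u x ((g.inner x).inverse (mvfderiv I u x))

variable [MeasurableSpace E] [BorelSpace E] [MeasurableSpace M]

/-- The measure `√(det g_{ij}) dy` on the domain of the chart around `x₀`, extended by zero. -/
def chartVolume (g : SmoothMetric I M) (x₀ : M) : Measure M :=
  (((Module.finBasis ℝ E).addHaar.restrict (extChartAt I x₀).target).withDensity fun y ↦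
    ENNReal.ofReal √(Matrix.det (Matrix.of fun i j ↦
      metricInChart g x₀ y (Module.finBasis ℝ E i) (Module.finBasis ℝ E j)))).map
    (extChartAt I x₀).symm

/-- The Riemannian volume measure `dv^g`. The measures `chartVolume g x₀` agree on the overlaps of
the charts, and the volume measure is the smallest measure that dominates all of them. On a
second countable manifold this is the unique measure whose restriction to the domain of the
chart around `x₀` is `chartVolume g x₀`, for every `x₀`. -/
def riemannianVolume (g : SmoothMetric I M) : Measure M := ⨆ x₀ : M, chartVolume g x₀

end Manifold

/-- The constant `a_m = 4(m-1)/(m-2)`. -/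
def yamabeCoeff (m : ℕ) : ℝ := 4 * ((m : ℝ) - 1) / ((m : ℝ) - 2)

/-- The exponent `p_m = 2m/(m-2)`. -/
def yamabeExp (m : ℕ) : ℝ := 2 * (m : ℝ) / ((m : ℝ) - 2)

section Functional

variable {E : Type*} [NormedAddCommGroup E] [NormedSpace ℝ E] [FiniteDimensional ℝ E]
  [MeasurableSpace E] [BorelSpace E]
  {H : Type*} [TopologicalSpace H] {I : ModelWithCorners ℝ E H}
  {M : Type*} [TopologicalSpace M] [ChartedSpace H M] [IsManifold I ∞ M] [MeasurableSpace M]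

/-- The Yamabe functional `F^g(u)`, with `m = dim M`. -/
def yamabeFunctional (g : SmoothMetric I M) (u : M → ℝ) : ℝ :=
  (∫ x, (yamabeCoeff (Module.finrank ℝ E) * normSqDiff g u x + scalarCurvature g x * u x ^ 2)
      ∂riemannianVolume g) /
    (∫ x, |u x| ^ yamabeExp (Module.finrank ℝ E) ∂riemannianVolume g) ^ (2 / yamabeExp (Module.finrank ℝ E))

variable (I M) in
/-- The smooth compactly supported functions on `M` that do not vanish identically. -/
def testFunctions : Set (M → ℝ) :=
  {u | ContMDiff I 𝓘(ℝ, ℝ) ∞ u ∧ HasCompactSupport u ∧ u ≠ 0}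

/-- The conformal Yamabe constant `μ(M, g)`. It can be `-∞` on a non-compact manifold, hence the
extended real values. -/
def yamabeConstant (g : SmoothMetric I M) : EReal :=
  ⨅ u ∈ testFunctions I M, (yamabeFunctional g u : EReal)

/-- On a non-empty manifold the Yamabe constant is not `+∞`; so it is a real number if it is
nonnegative. -/
theorem yamabeConstant_ne_top [T2Space M] [Nonempty M] (g : SmoothMetric I M) :
    yamabeConstant g ≠ ⊤ := by
  obtain ⟨x⟩ := ‹Nonempty M›
  obtain ⟨f⟩ : Nonempty (SmoothBumpFunction I x) := inferInstance
  have hf : (f : M → ℝ) ∈ testFunctions I M := by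
    refine ⟨f.contMDiff, f.hasCompactSupport, fun h ↦ ?_⟩
    have h1 : f x = 1 := f.eq_one
    rw [h] at h1
    exact zero_ne_one h1
  exact ((iInf₂_le _ hf).trans_lt (EReal.coe_lt_top _)).ne

/-- The invariant `ν(M, g) = (μ(M, g) / (m a_m))^m`, with `m = dim M`; it is used only for
manifolds with `μ(M, g) ≥ 0`. -/
def yamabeNu (g : SmoothMetric I M) : ℝ :=
  ((yamabeConstant g).toReal / (Module.finrank ℝ E * yamabeCoeff (Module.finrank ℝ E))) ^
    Module.finrank ℝ E

end Functional

end

end Yamabe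

open Yamabe

/-! Write `θ = v/m` and `η = w/m`. For a test function `u` on `V × W`, the differential splits
orthogonally into the differentials of the slices, and `s^G = s^g + s^h`. The curvature hypothesis,
multiplied by `a_m u²`, therefore bounds the Yamabe density of `u` from below by `a_m (e_V / a_v +
e_W / a_w)`, where `e_V` and `e_W` are the densities of the slices in the two factors
(`yamabeDensity_prodMetric_ge`).

Since `dv^G` is the product measure, Fubini and the Yamabe inequality on every slice give `∫ e_V ≥
μ(V) A` and `∫ e_W ≥ μ(W) B`. Here `A` is the squared norm of `u` in `L²_y(L^{p_v}_x)` and `B` the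
one in `L²_x(L^{p_w}_y)` (`yamabeConstant_mul_lintegral_le`). Weighted AM-GM with weights `θ`, `η`
turns the sum into a multiple of `A^θ B^η`, with exactly the constant of the theorem
(`yamabe_am_gm`). What remains is `‖u‖²_{p_m} ≤ A^θ B^η` (`lintegral_prod_rpow_le_mixed`). This is
Hölder interpolation between `L²_y(L^{p_v}_x)` and `L^{p_w}_y(L²_x)`, and Minkowski's inequality
bounds the latter norm by `L²_x(L^{p_w}_y)`, because `p_w > 2`.

The rest is geometry: the scalar curvature, the norm of the differential and the volume of a product
(`scalarCurvature_prodMetric`, `normSqDiff_prodMetric`, `riemannianVolume_prodMetric`), and the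
continuity needed for integrability. As curvature and volume are defined through charts, continuity
and gluing rest on their invariance under changes of charts. -/

namespace Yamabe

noncomputable section

/-! ### Minkowski's inequality and interpolation of mixed norms -/

section MixedNorm

open scoped ENNReal

variable {X Y : Type*} [MeasurableSpace X] [MeasurableSpace Y] {μ : Measure X} {ν : Measure Y}
  [SFinite μ] [SFinite ν]

/-- Minkowski's integral inequality. -/
theorem lintegral_lintegral_rpow_le {f : X → Y → ℝ≥0∞} (hf : Measurable (Function.uncurry f))
    {q : ℝ} (hq : 1 < q) (hfin : ∫⁻ y, (∫⁻ x, f x y ∂μ) ^ q ∂ν ≠ ⊤) :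
    (∫⁻ y, (∫⁻ x, f x y ∂μ) ^ q ∂ν) ^ (1 / q) ≤ ∫⁻ x, (∫⁻ y, f x y ^ q ∂ν) ^ (1 / q) ∂μ := by
  set F : Y → ℝ≥0∞ := fun y ↦ ∫⁻ x, f x y ∂μ with hF
  have hFm : Measurable F := hf.lintegral_prod_left'
  have hf' : Measurable (Function.uncurry fun y x ↦ f x y) := hf.comp measurable_swap
  set J := ∫⁻ y, F y ^ q ∂ν with hJ
  set B := ∫⁻ x, (∫⁻ y, f x y ^ q ∂ν) ^ (1 / q) ∂μ with hB
  rcases eq_or_ne J 0 with h0 | h0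
  · rw [h0, ENNReal.zero_rpow_of_pos (by positivity)]; exact zero_le
  have hpq := Real.HolderConjugate.conjExponent hq
  set r := q.conjExponent
  have hqr : (q - 1) * r = q := by
    have := hpq.sub_one_mul_conj; linarith
  -- Write `F^q = F · F^(q-1)`, exchange the integrals and apply Hölder in `y`. Since `(q - 1) r =
  -- q`, the second factor is `J^(1/r)`, which is then cancelled; this needs `0 < J < ∞`.
  have key : J ≤ B * J ^ (1 / r) := by
    calc J = ∫⁻ y, ∫⁻ x, f x y * F y ^ (q - 1) ∂μ ∂ν := by
          refine lintegral_congr fun y ↦ ?_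
          have hfy : Measurable fun x ↦ f x y := hf.comp measurable_prodMk_right
          rw [lintegral_mul_const _ hfy]
          change F y ^ q = F y * F y ^ (q - 1)
          nth_rewrite 2 [← ENNReal.rpow_one (F y)]
          rw [← ENNReal.rpow_add_of_nonneg _ _ zero_le_one (by linarith)]
          congr 1; ring
      _ = ∫⁻ x, ∫⁻ y, f x y * F y ^ (q - 1) ∂ν ∂μ := by
          rw [lintegral_lintegral_swap]
          exact (hf'.mul ((hFm.comp measurable_fst).pow_const _)).aemeasurable
      _ ≤ ∫⁻ x, (∫⁻ y, f x y ^ q ∂ν) ^ (1 / q) * J ^ (1 / r) ∂μ := by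
          refine lintegral_mono fun x ↦ ?_
          refine (ENNReal.lintegral_mul_le_Lp_mul_Lq ν hpq
            (hf.comp measurable_prodMk_left).aemeasurable
            (hFm.pow_const (q - 1)).aemeasurable).trans_eq ?_
          congr 2
          refine lintegral_congr fun y ↦ ?_
          rw [← ENNReal.rpow_mul, hqr]
      _ = B * J ^ (1 / r) := lintegral_mul_const _
          (((hf.pow_const q).lintegral_prod_right').pow_const _)
  have hsplit : J = J ^ (1 / q) * J ^ (1 / r) := by
    rw [← ENNReal.rpow_add _ _ h0 hfin]
    have := hpq.inv_add_inv_eq_one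
    rw [one_div, one_div, this, ENNReal.rpow_one]
  have hJr0 : J ^ (1 / r) ≠ 0 := by
    simp only [ne_eq, ENNReal.rpow_eq_zero_iff, h0, hfin, false_and, or_self, not_false_eq_true]
  have hJrt : J ^ (1 / r) ≠ ⊤ := ENNReal.rpow_ne_top_of_nonneg (by
    have := hpq.symm.pos; positivity) hfin
  exact (ENNReal.mul_le_mul_iff_left hJr0 hJrt).1 (hsplit ▸ key)

/-- Interpolation between the mixed norms `L²_y(L^a_x)` and `L²_x(L^b_y)`. -/
theorem lintegral_prod_rpow_le_mixed {f : X → Y → ℝ≥0∞} (hf : Measurable (Function.uncurry f))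
    {p a b θ : ℝ} (hp : 0 < p) (ha : 0 < a) (hb : 2 < b) (hθ : 0 < θ) (hθ' : θ < 1)
    (h1 : θ * p / a + (1 - θ) * p / 2 = 1) (h2 : θ * p / 2 + (1 - θ) * p / b = 1)
    (hfin : ∫⁻ y, (∫⁻ x, f x y ^ (2 : ℝ) ∂μ) ^ (b / 2) ∂ν ≠ ⊤) :
    (∫⁻ y, ∫⁻ x, f x y ^ p ∂μ ∂ν) ^ (2 / p) ≤
      (∫⁻ y, (∫⁻ x, f x y ^ a ∂μ) ^ (2 / a) ∂ν) ^ θ *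
      (∫⁻ x, (∫⁻ y, f x y ^ b ∂ν) ^ (2 / b) ∂μ) ^ (1 - θ) := by
  have hθ1 : 0 < 1 - θ := by linarith
  have hm (r : ℝ) (y : Y) : Measurable fun x ↦ f x y ^ r :=
    (hf.comp measurable_prodMk_right).pow_const r
  have hm' (r : ℝ) : Measurable fun y ↦ ∫⁻ x, f x y ^ r ∂μ :=
    (hf.pow_const r).lintegral_prod_left'
  -- Hölder twice: in `x` with the weights of `h1`, applied to `f^a` and `f²`, then in `y` with the
  -- weights of `h2`.
  have step : ∫⁻ y, ∫⁻ x, f x y ^ p ∂μ ∂ν ≤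
      (∫⁻ y, (∫⁻ x, f x y ^ a ∂μ) ^ (2 / a) ∂ν) ^ (θ * p / 2) *
      (∫⁻ y, (∫⁻ x, f x y ^ (2 : ℝ) ∂μ) ^ (b / 2) ∂ν) ^ ((1 - θ) * p / b) := by
    calc _ ≤ ∫⁻ y, ((∫⁻ x, f x y ^ a ∂μ) ^ (2 / a)) ^ (θ * p / 2) *
          ((∫⁻ x, f x y ^ (2 : ℝ) ∂μ) ^ (b / 2)) ^ ((1 - θ) * p / b) ∂ν := by
          refine lintegral_mono fun y ↦ ?_
          have := ENNReal.lintegral_mul_norm_pow_le (μ := μ) (hm a y).aemeasurable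
            (hm 2 y).aemeasurable (p := θ * p / a) (q := (1 - θ) * p / 2)
            (by positivity) (by positivity) h1
          convert this using 1
          · refine lintegral_congr fun x ↦ ?_
            rw [← ENNReal.rpow_mul, ← ENNReal.rpow_mul,
              ← ENNReal.rpow_add_of_nonneg _ _ (by positivity) (by positivity)]
            congr 1; field_simp; ring
          · rw [← ENNReal.rpow_mul, ← ENNReal.rpow_mul]
            congr 2 <;> field_simp
      _ ≤ _ := ENNReal.lintegral_mul_norm_pow_le ((hm' a).pow_const _).aemeasurable
          ((hm' 2).pow_const _).aemeasurable (by positivity) (by positivity) h2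
  -- Minkowski for `f²` with exponent `b/2 > 1` exchanges the order of the norms: `L^b_y(L²_x)` is
  -- bounded by `L²_x(L^b_y)`.
  have mink := lintegral_lintegral_rpow_le (μ := μ) (ν := ν) (f := fun x y ↦ f x y ^ (2 : ℝ))
    (hf.pow_const 2) (q := b / 2) (by linarith) hfin
  simp only [← ENNReal.rpow_mul] at mink
  rw [show 2 * (b / 2) = b by ring, show 1 / (b / 2) = 2 / b by field_simp] at mink
  calc _ ≤ _ := ENNReal.rpow_le_rpow step (by positivity)
    _ = (∫⁻ y, (∫⁻ x, f x y ^ a ∂μ) ^ (2 / a) ∂ν) ^ θ *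
      ((∫⁻ y, (∫⁻ x, f x y ^ (2 : ℝ) ∂μ) ^ (b / 2) ∂ν) ^ (2 / b)) ^ (1 - θ) := by
        rw [ENNReal.mul_rpow_of_nonneg _ _ (by positivity), ← ENNReal.rpow_mul, ← ENNReal.rpow_mul,
          ← ENNReal.rpow_mul]
        congr 2 <;> field_simp
    _ ≤ _ := by gcongr

end MixedNorm

/-! ### Curvature in coordinates: smoothness and traces -/

section LocalCurvature

set_option maxSynthPendingDepth 3

open ContinuousLinearMap

variable {E : Type*} [NormedAddCommGroup E] [NormedSpace ℝ E]

/-- `b` is a smooth nondegenerate metric on the open set `S`. -/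
structure IsMetricOn (b : E → E →L[ℝ] E →L[ℝ] ℝ) (S : Set E) : Prop where
  isOpen : IsOpen S
  contDiffOn : ContDiffOn ℝ ∞ b S
  invertible : ∀ y ∈ S, (b y).IsInvertible
  symm : ∀ y ∈ S, ∀ v w, b y v w = b y w v

/-- The Christoffel symbol as a continuous bilinear map. -/
def christoffelCLM (b : E → E →L[ℝ] E →L[ℝ] ℝ) (y : E) : E →L[ℝ] E →L[ℝ] E :=
  (compL ℝ E (E →L[ℝ] ℝ) E (b y).inverse) ∘L ((1 / 2 : ℝ) •
    (fderiv ℝ b y + (fderiv ℝ b y).flip -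
      (flipₗᵢ ℝ E E ℝ : (E →L[ℝ] E →L[ℝ] ℝ) →L[ℝ] _) ∘L (fderiv ℝ b y).flip))

variable {b : E → E →L[ℝ] E →L[ℝ] ℝ} {S : Set E}

theorem IsMetricOn.contDiffAt (hb : IsMetricOn b S) {y : E} (hy : y ∈ S) : ContDiffAt ℝ ∞ b y :=
  hb.contDiffOn.contDiffAt (hb.isOpen.mem_nhds hy)

theorem IsMetricOn.differentiableAt (hb : IsMetricOn b S) {y : E} (hy : y ∈ S) :
    DifferentiableAt ℝ b y :=
  (hb.contDiffAt hy).differentiableAt (by simp)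

/-- Lowering the index cancels the inverse of `b` and leaves the Koszul formula. With
`IsMetricOn.ext_apply`, identities between Christoffel symbols can then be checked after pairing
with an arbitrary vector. -/
theorem IsMetricOn.apply_christoffel (hb : IsMetricOn b S) {y : E} (hy : y ∈ S) (v w u : E) :
    b y (christoffel b y v w) u =
      1 / 2 * (fderiv ℝ b y v w u + fderiv ℝ b y w v u - fderiv ℝ b y u v w) := by
  rw [christoffel, (hb.invertible y hy).self_apply_inverse]
  rfl

theorem IsMetricOn.ext_apply (hb : IsMetricOn b S) {y : E} (hy : y ∈ S) {p q : E}
    (h : ∀ u, b y p u = b y q u) : p = q :=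
  (hb.invertible y hy).bijective.injective (ContinuousLinearMap.ext h)

variable [FiniteDimensional ℝ E]

theorem IsMetricOn.contDiffAt_inverse (hb : IsMetricOn b S) {y : E} (hy : y ∈ S) :
    ContDiffAt ℝ ∞ (fun y ↦ (b y).inverse) y := by
  have := FiniteDimensional.complete ℝ E
  exact ((hb.invertible y hy).contDiffAt_map_inverse).comp y (hb.contDiffAt hy)

theorem IsMetricOn.contDiffAt_christoffelCLM (hb : IsMetricOn b S) {y : E} (hy : y ∈ S) :
    ContDiffAt ℝ ∞ (christoffelCLM b) y := by
  have hD : ContDiffAt ℝ ∞ (fderiv ℝ b) y := (hb.contDiffAt hy).fderiv_right (by simp)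
  have hF : ContDiffAt ℝ ∞ (fun y ↦ (fderiv ℝ b y).flip) y :=
    (flipₗᵢ ℝ E E (E →L[ℝ] ℝ)).contDiff.contDiffAt.comp y hD
  exact ((compL ℝ E (E →L[ℝ] ℝ) E).contDiff.contDiffAt.comp y (hb.contDiffAt_inverse hy)).clm_comp
    (((hD.add hF).sub (contDiffAt_const.clm_comp hF)).const_smul (1 / 2 : ℝ))

theorem IsMetricOn.differentiableAt_christoffelCLM (hb : IsMetricOn b S) {y : E} (hy : y ∈ S) :
    DifferentiableAt ℝ (christoffelCLM b) y :=
  (hb.contDiffAt_christoffelCLM hy).differentiableAt (by simp)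

theorem IsMetricOn.fderiv_christoffel (hb : IsMetricOn b S) {y : E} (hy : y ∈ S) (u v w : E) :
    fderiv ℝ (fun z ↦ christoffel b z v w) y u = fderiv ℝ (christoffelCLM b) y u v w := by
  have h := (((hb.differentiableAt_christoffelCLM hy).hasFDerivAt.clm_apply
    (hasFDerivAt_const v y)).clm_apply (hasFDerivAt_const w y)).fderiv
  have h' : (fun z ↦ christoffel b z v w) = fun z ↦ christoffelCLM b z v w := rfl
  rw [h', h]
  simp

/-- The Riemann curvature tensor in terms of the derivative of the Christoffel map. -/
theorem IsMetricOn.curvatureTensor_eq (hb : IsMetricOn b S) {y : E} (hy : y ∈ S) (u v w : E) :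
    curvatureTensor b y u v w =
      fderiv ℝ (christoffelCLM b) y u v w - fderiv ℝ (christoffelCLM b) y v u w +
        christoffelCLM b y u (christoffelCLM b y v w) -
        christoffelCLM b y v (christoffelCLM b y u w) := by
  rw [curvatureTensor, hb.fderiv_christoffel hy, hb.fderiv_christoffel hy]
  rfl

/-! ### Independence of the basis -/

/-- The coordinate functionals of a basis, as continuous linear maps. -/
def coordL {ι : Type*} (c : Module.Basis ι ℝ E) (i : ι) : E →L[ℝ] ℝ :=
  LinearMap.toContinuousLinearMap (c.coord i)

theorem coordL_apply {ι : Type*} (c : Module.Basis ι ℝ E) (i : ι) (x : E) :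
    coordL c i x = c.repr x i := rfl

/-- The trace of a bilinear form on `E × E^*` does not depend on the basis. -/
theorem sum_coordL_eq {ι κ : Type*} [Fintype ι] [Fintype κ] (c : Module.Basis ι ℝ E)
    (d : Module.Basis κ ℝ E) (β : E →ₗ[ℝ] (E →L[ℝ] ℝ) →ₗ[ℝ] ℝ) :
    ∑ i, β (c i) (coordL c i) = ∑ j, β (d j) (coordL d j) := by
  have h1 (i : ι) : coordL c i = ∑ j, c.repr (d j) i • coordL d j := by
    ext x
    conv_lhs => rw [← d.sum_repr x, map_sum]
    simp [coordL_apply, mul_comm]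
  calc ∑ i, β (c i) (coordL c i)
      = ∑ i, ∑ j, c.repr (d j) i * β (c i) (coordL d j) := by
        refine Finset.sum_congr rfl fun i _ ↦ ?_
        conv_lhs => rw [h1 i]
        simp
    _ = ∑ j, ∑ i, c.repr (d j) i * β (c i) (coordL d j) := Finset.sum_comm
    _ = ∑ j, β (d j) (coordL d j) := by
        refine Finset.sum_congr rfl fun j _ ↦ ?_
        conv_rhs => rw [← c.sum_repr (d j), map_sum, LinearMap.sum_apply]
        simp only [map_smul, LinearMap.smul_apply, smul_eq_mul]

/-- The curvature is linear in its first slot, so this is the trace of a bilinear form on `E × E^*`.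
Freedom of basis is needed twice: for a basis transported by a coordinate change and for the basis
of a product. -/
theorem IsMetricOn.ricciTensor_eq (hb : IsMetricOn b S) {y : E} (hy : y ∈ S) {ι : Type*}
    [Fintype ι] (c : Module.Basis ι ℝ E) (v w : E) :
    ricciTensor b y v w = ∑ i, coordL c i (curvatureTensor b y (c i) v w) := by
  let β : E →ₗ[ℝ] (E →L[ℝ] ℝ) →ₗ[ℝ] ℝ := LinearMap.mk₂ ℝ
    (fun u α ↦ α (curvatureTensor b y u v w))
    (fun u u' α ↦ by simp only [hb.curvatureTensor_eq hy, map_add, map_sub, add_apply]; ring)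
    (fun r u α ↦ by
      simp only [hb.curvatureTensor_eq hy, map_add, map_sub, map_smul, smul_apply, smul_eq_mul]
      ring)
    (fun u α α' ↦ rfl) (fun r u α ↦ rfl)
  exact sum_coordL_eq (Module.finBasis ℝ E) c β

theorem IsMetricOn.scalarCurvatureAt_eq (hb : IsMetricOn b S) {y : E} (hy : y ∈ S) {ι : Type*}
    [Fintype ι] (c : Module.Basis ι ℝ E) :
    scalarCurvatureAt b y =
      ∑ i, ∑ j, coordL c j (curvatureTensor b y (c j) (c i) ((b y).inverse (coordL c i))) := by
  let β : E →ₗ[ℝ] (E →L[ℝ] ℝ) →ₗ[ℝ] ℝ := LinearMap.mk₂ ℝ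
    (fun v α ↦ ricciTensor b y v ((b y).inverse α))
    (fun u u' α ↦ by
      simp only [ricciTensor, ← Finset.sum_add_distrib]
      refine Finset.sum_congr rfl fun i _ ↦ ?_
      simp only [hb.curvatureTensor_eq hy, map_add, map_sub, add_apply]; ring)
    (fun r u α ↦ by
      simp only [ricciTensor, Finset.smul_sum]
      refine Finset.sum_congr rfl fun i _ ↦ ?_
      simp only [hb.curvatureTensor_eq hy, map_add, map_sub, map_smul, smul_apply, smul_eq_mul]
      ring)
    (fun u α α' ↦ by
      simp only [ricciTensor, ← Finset.sum_add_distrib]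
      refine Finset.sum_congr rfl fun i _ ↦ ?_
      simp only [hb.curvatureTensor_eq hy, map_add, map_sub]; ring)
    (fun r u α ↦ by
      simp only [ricciTensor, Finset.smul_sum]
      refine Finset.sum_congr rfl fun i _ ↦ ?_
      simp only [hb.curvatureTensor_eq hy, map_add, map_sub, map_smul, smul_eq_mul]
      ring)
  refine (sum_coordL_eq (Module.finBasis ℝ E) c β).trans ?_
  exact Finset.sum_congr rfl fun i _ ↦ hb.ricciTensor_eq hy c _ _

theorem IsMetricOn.continuousOn_scalarCurvatureAt (hb : IsMetricOn b S) :
    ContinuousOn (scalarCurvatureAt b) S := by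
  have h : ∀ y ∈ S, scalarCurvatureAt b y = _ := fun y hy ↦
    hb.scalarCurvatureAt_eq hy (Module.finBasis ℝ E)
  refine ContinuousOn.congr ?_ h
  refine continuousOn_finsetSum _ fun i _ ↦ continuousOn_finsetSum _ fun j _ ↦ ?_
  refine ContinuousOn.congr ?_ fun y hy ↦ congrArg _ (hb.curvatureTensor_eq hy _ _ _)
  have hG : ContinuousOn (christoffelCLM b) S := fun y hy ↦
    (hb.contDiffAt_christoffelCLM hy).continuousAt.continuousWithinAt
  have hD : ContinuousOn (fderiv ℝ (christoffelCLM b)) S := fun y hy ↦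
    ((hb.contDiffAt_christoffelCLM hy).fderiv_right (m := ∞)
      (by simp)).continuousAt.continuousWithinAt
  have hI : ContinuousOn (fun y ↦ (b y).inverse) S := fun y hy ↦
    (hb.contDiffAt_inverse hy).continuousAt.continuousWithinAt
  fun_prop

end LocalCurvature

/-! ### Invariance of the curvature under local diffeomorphisms -/

section Pullback

set_option maxSynthPendingDepth 3

open ContinuousLinearMap

variable {E : Type*} [NormedAddCommGroup E] [NormedSpace ℝ E]
  {F : Type*} [NormedAddCommGroup F] [NormedSpace ℝ F]

/-- `b'` is the pullback of `b` under the local diffeomorphism `φ`. -/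
structure IsPullbackOn (φ : E → F) (b' : E → E →L[ℝ] E →L[ℝ] ℝ) (b : F → F →L[ℝ] F →L[ℝ] ℝ)
    (U : Set E) (S : Set F) : Prop where
  source : IsMetricOn b' U
  target : IsMetricOn b S
  contDiffOn : ContDiffOn ℝ ∞ φ U
  mapsTo : Set.MapsTo φ U S
  invertible : ∀ z ∈ U, (fderiv ℝ φ z).IsInvertible
  apply_eq : ∀ z ∈ U, ∀ v w, b' z v w = b (φ z) (fderiv ℝ φ z v) (fderiv ℝ φ z w)

namespace IsPullbackOn

variable {φ : E → F} {b' : E → E →L[ℝ] E →L[ℝ] ℝ} {b : F → F →L[ℝ] F →L[ℝ] ℝ}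
  {U : Set E} {S : Set F}

theorem contDiffAt (h : IsPullbackOn φ b' b U S) {z : E} (hz : z ∈ U) : ContDiffAt ℝ ∞ φ z :=
  h.contDiffOn.contDiffAt (h.source.isOpen.mem_nhds hz)

theorem hasFDerivAt (h : IsPullbackOn φ b' b U S) {z : E} (hz : z ∈ U) :
    HasFDerivAt φ (fderiv ℝ φ z) z :=
  ((h.contDiffAt hz).differentiableAt (by simp)).hasFDerivAt

theorem hasFDerivAt_fderiv (h : IsPullbackOn φ b' b U S) {z : E} (hz : z ∈ U) :
    HasFDerivAt (fderiv ℝ φ) (fderiv ℝ (fderiv ℝ φ) z) z :=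
  (((h.contDiffAt hz).fderiv_right (m := ∞) (by simp)).differentiableAt (by simp)).hasFDerivAt

theorem hasFDerivAt_fderiv_fderiv (h : IsPullbackOn φ b' b U S) {z : E} (hz : z ∈ U) :
    HasFDerivAt (fderiv ℝ (fderiv ℝ φ)) (fderiv ℝ (fderiv ℝ (fderiv ℝ φ)) z) z :=
  ((((h.contDiffAt hz).fderiv_right (m := ∞) (by simp)).fderiv_right (m := ∞)
    (by simp)).differentiableAt (by simp)).hasFDerivAt

theorem fderiv_fderiv_symm (h : IsPullbackOn φ b' b U S) {z : E} (hz : z ∈ U) (v w : E) :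
    fderiv ℝ (fderiv ℝ φ) z v w = fderiv ℝ (fderiv ℝ φ) z w v :=
  (h.contDiffAt hz).isSymmSndFDerivAt (by simpa using ENat.LEInfty.out) v w

theorem fderiv_fderiv_fderiv_symm (h : IsPullbackOn φ b' b U S) {z : E} (hz : z ∈ U) (u v w : E) :
    fderiv ℝ (fderiv ℝ (fderiv ℝ φ)) z u v w = fderiv ℝ (fderiv ℝ (fderiv ℝ φ)) z v u w := by
  have := ((h.contDiffAt hz).fderiv_right (m := ∞) (by simp)).isSymmSndFDerivAt (by simpa using ENat.LEInfty.out) u v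
  exact congrArg (fun L ↦ L w) this

/-- The derivative of the pullback metric. -/
theorem fderiv_apply (h : IsPullbackOn φ b' b U S) {z : E} (hz : z ∈ U) (u v w : E) :
    fderiv ℝ b' z u v w =
      fderiv ℝ b (φ z) (fderiv ℝ φ z u) (fderiv ℝ φ z v) (fderiv ℝ φ z w) +
        b (φ z) (fderiv ℝ (fderiv ℝ φ) z u v) (fderiv ℝ φ z w) +
        b (φ z) (fderiv ℝ φ z v) (fderiv ℝ (fderiv ℝ φ) z u w) := by
  have h1 := ((((h.source.differentiableAt hz).hasFDerivAt.clm_apply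
    (hasFDerivAt_const v z)).clm_apply (hasFDerivAt_const w z)))
  have h2 := ((((h.target.differentiableAt (h.mapsTo hz)).hasFDerivAt.comp z
    (h.hasFDerivAt hz)).clm_apply ((h.hasFDerivAt_fderiv hz).clm_apply
      (hasFDerivAt_const v z))).clm_apply ((h.hasFDerivAt_fderiv hz).clm_apply
      (hasFDerivAt_const w z)))
  have heq : (fun z ↦ b' z v w) =ᶠ[𝓝 z]
      fun z ↦ b (φ z) (fderiv ℝ φ z v) (fderiv ℝ φ z w) := by
    filter_upwards [h.source.isOpen.mem_nhds hz] with x hx using h.apply_eq x hx v w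
  have := congrArg (fun L ↦ L u) (h1.unique (h2.congr_of_eventuallyEq heq))
  simp at this
  rw [this]
  ring

/-- The transformation law of the Christoffel symbols. -/
theorem fderiv_christoffel (h : IsPullbackOn φ b' b U S) {z : E} (hz : z ∈ U) (v w : E) :
    fderiv ℝ φ z (christoffel b' z v w) =
      christoffel b (φ z) (fderiv ℝ φ z v) (fderiv ℝ φ z w) + fderiv ℝ (fderiv ℝ φ) z v w := by
  have hφz := h.mapsTo hz
  refine h.target.ext_apply hφz fun u ↦ ?_
  obtain ⟨u, rfl⟩ := (h.invertible z hz).bijective.surjective u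
  -- Expanding the three derivatives of the pullback metric gives six terms with `D²φ`. By the
  -- symmetry of `D²φ`, four cancel and the other two add up to `2 b(D²φ(v, w), Dφ u)`.
  rw [← h.apply_eq z hz, h.source.apply_christoffel hz, map_add, add_apply,
    h.target.apply_christoffel hφz, h.fderiv_apply hz, h.fderiv_apply hz, h.fderiv_apply hz,
    h.fderiv_fderiv_symm hz w v, h.fderiv_fderiv_symm hz u v, h.fderiv_fderiv_symm hz u w,
    h.target.symm _ hφz (fderiv ℝ φ z w)]
  ring

variable [FiniteDimensional ℝ E] [FiniteDimensional ℝ F]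

/-- The transformation law of the Christoffel symbols, differentiated by the product rule. The last
term comes from the derivative of `Dφ` on the left side of that law. -/
theorem fderiv_fderiv_christoffelCLM (h : IsPullbackOn φ b' b U S) {z : E} (hz : z ∈ U)
    (u v w : E) :
    fderiv ℝ φ z (fderiv ℝ (christoffelCLM b') z u v w) =
      fderiv ℝ (christoffelCLM b) (φ z) (fderiv ℝ φ z u) (fderiv ℝ φ z v) (fderiv ℝ φ z w) +
      christoffelCLM b (φ z) (fderiv ℝ (fderiv ℝ φ) z u v) (fderiv ℝ φ z w) +
      christoffelCLM b (φ z) (fderiv ℝ φ z v) (fderiv ℝ (fderiv ℝ φ) z u w) +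
      fderiv ℝ (fderiv ℝ (fderiv ℝ φ)) z u v w -
      fderiv ℝ (fderiv ℝ φ) z u (christoffelCLM b' z v w) := by
  have hφz := h.mapsTo hz
  have h1 := (h.hasFDerivAt_fderiv hz).clm_apply
    (((h.source.differentiableAt_christoffelCLM hz).hasFDerivAt.clm_apply
    (hasFDerivAt_const v z)).clm_apply (hasFDerivAt_const w z))
  have h2 := ((((h.target.differentiableAt_christoffelCLM hφz).hasFDerivAt.comp z
    (h.hasFDerivAt hz)).clm_apply ((h.hasFDerivAt_fderiv hz).clm_apply
      (hasFDerivAt_const v z))).clm_apply ((h.hasFDerivAt_fderiv hz).clm_apply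
      (hasFDerivAt_const w z))).add (((h.hasFDerivAt_fderiv_fderiv hz).clm_apply
      (hasFDerivAt_const v z)).clm_apply (hasFDerivAt_const w z))
  have heq : (fun z ↦ fderiv ℝ φ z (christoffelCLM b' z v w)) =ᶠ[𝓝 z] fun z ↦
      christoffelCLM b (φ z) (fderiv ℝ φ z v) (fderiv ℝ φ z w) +
        fderiv ℝ (fderiv ℝ φ) z v w := by
    filter_upwards [h.source.isOpen.mem_nhds hz] with x hx using h.fderiv_christoffel hx v w
  have := congrArg (fun L ↦ L u) (h1.unique (h2.congr_of_eventuallyEq heq))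
  simp at this
  rw [eq_sub_iff_add_eq, this]
  abel

/-- The curvature tensor is natural. -/
theorem fderiv_curvatureTensor (h : IsPullbackOn φ b' b U S) {z : E} (hz : z ∈ U) (u v w : E) :
    fderiv ℝ φ z (curvatureTensor b' z u v w) =
      curvatureTensor b (φ z) (fderiv ℝ φ z u) (fderiv ℝ φ z v) (fderiv ℝ φ z w) := by
  have hφz := h.mapsTo hz
  have hc (v w : E) : fderiv ℝ φ z (christoffelCLM b' z v w) =
      christoffelCLM b (φ z) (fderiv ℝ φ z v) (fderiv ℝ φ z w) + fderiv ℝ (fderiv ℝ φ) z v w :=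
    h.fderiv_christoffel hz v w
  rw [h.source.curvatureTensor_eq hz, h.target.curvatureTensor_eq hφz]
  -- Antisymmetrizing in `u`, `v` removes `D³φ` and `Γ(D²φ(u, v), ·)`. The terms `Γ(Dφ u, D²φ(v,
  -- w))` and `D²φ(u, Γ'(v, w))` cancel between the derivative part and the quadratic part.
  simp only [map_add, map_sub, hc, h.fderiv_fderiv_christoffelCLM hz,
    h.fderiv_fderiv_fderiv_symm hz v u, h.fderiv_fderiv_symm hz v u]
  abel

/-- The scalar curvature does not depend on the coordinates. -/
theorem scalarCurvatureAt_eq (h : IsPullbackOn φ b' b U S) {z : E} (hz : z ∈ U) :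
    scalarCurvatureAt b' z = scalarCurvatureAt b (φ z) := by
  have hφz := h.mapsTo hz
  obtain ⟨A, hA⟩ := h.invertible z hz
  set c := Module.finBasis ℝ E
  have hcoord (i) (x : E) : coordL (c.map A.toLinearEquiv) i (A x) = coordL c i x := by
    simp [coordL_apply]
  have hAv (v : E) : fderiv ℝ φ z v = A v := by rw [← hA]; rfl
  -- Raising an index commutes with `Dφ`. With the source trace taken in `c` and the target trace in
  -- `c.map A`, the two double sums agree term by term.
  have hinv (i) : A ((b' z).inverse (coordL c i)) =
      (b (φ z)).inverse (coordL (c.map A.toLinearEquiv) i) := by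
    refine h.target.ext_apply hφz fun u ↦ ?_
    obtain ⟨u, rfl⟩ := A.surjective u
    rw [(h.target.invertible _ hφz).self_apply_inverse, hcoord, ← hAv, ← hAv, ← h.apply_eq z hz,
      (h.source.invertible _ hz).self_apply_inverse]
  rw [h.source.scalarCurvatureAt_eq hz c, h.target.scalarCurvatureAt_eq hφz (c.map A.toLinearEquiv)]
  refine Finset.sum_congr rfl fun i _ ↦ Finset.sum_congr rfl fun j _ ↦ ?_
  rw [← hinv i, ← hcoord, ← hAv, h.fderiv_curvatureTensor hz]
  simp only [hAv]
  rfl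

end IsPullbackOn

end Pullback

/-! ### Curvature of a product metric in coordinates -/

section Product

set_option maxSynthPendingDepth 3

open ContinuousLinearMap

variable {E : Type*} [NormedAddCommGroup E] [NormedSpace ℝ E]
  {F : Type*} [NormedAddCommGroup F] [NormedSpace ℝ F]

/-- On `S ×ˢ T` the metric `B` is the product of `b` and `c`. -/
structure IsProductOn (B : E × F → E × F →L[ℝ] E × F →L[ℝ] ℝ)
    (b : E → E →L[ℝ] E →L[ℝ] ℝ) (c : F → F →L[ℝ] F →L[ℝ] ℝ) (S : Set E) (T : Set F) : Prop where
  prod : IsMetricOn B (S ×ˢ T)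
  left : IsMetricOn b S
  right : IsMetricOn c T
  apply_eq : ∀ z ∈ S ×ˢ T, ∀ v w, B z v w = b z.1 v.1 w.1 + c z.2 v.2 w.2

namespace IsProductOn

variable {B : E × F → E × F →L[ℝ] E × F →L[ℝ] ℝ} {b : E → E →L[ℝ] E →L[ℝ] ℝ}
  {c : F → F →L[ℝ] F →L[ℝ] ℝ} {S : Set E} {T : Set F}

theorem fderiv_apply (h : IsProductOn B b c S T) {z : E × F} (hz : z ∈ S ×ˢ T) (u v w : E × F) :
    fderiv ℝ B z u v w = fderiv ℝ b z.1 u.1 v.1 w.1 + fderiv ℝ c z.2 u.2 v.2 w.2 := by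
  have h1 := ((((h.prod.differentiableAt hz).hasFDerivAt.clm_apply
    (hasFDerivAt_const v z)).clm_apply (hasFDerivAt_const w z)))
  have h2 := ((((h.left.differentiableAt hz.1).hasFDerivAt.comp z hasFDerivAt_fst).clm_apply
    (hasFDerivAt_const v.1 z)).clm_apply (hasFDerivAt_const w.1 z)).add
    ((((h.right.differentiableAt hz.2).hasFDerivAt.comp z hasFDerivAt_snd).clm_apply
    (hasFDerivAt_const v.2 z)).clm_apply (hasFDerivAt_const w.2 z))
  have heq : (fun z ↦ B z v w) =ᶠ[𝓝 z] fun z ↦ b z.1 v.1 w.1 + c z.2 v.2 w.2 := by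
    filter_upwards [h.prod.isOpen.mem_nhds hz] with x hx using h.apply_eq x hx v w
  have := congrArg (fun L ↦ L u) (h1.unique (h2.congr_of_eventuallyEq heq))
  simpa using this

/-- Each block of a product metric depends only on its own variable, so the derivatives in the
Koszul formula contain no mixed terms. -/
theorem christoffel_eq (h : IsProductOn B b c S T) {z : E × F} (hz : z ∈ S ×ˢ T) (v w : E × F) :
    christoffel B z v w = (christoffel b z.1 v.1 w.1, christoffel c z.2 v.2 w.2) := by
  refine h.prod.ext_apply hz fun u ↦ ?_
  rw [h.prod.apply_christoffel hz, h.apply_eq z hz, h.left.apply_christoffel hz.1,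
    h.right.apply_christoffel hz.2]
  simp only [h.fderiv_apply hz]
  ring

theorem inverse_apply (h : IsProductOn B b c S T) {z : E × F} (hz : z ∈ S ×ˢ T)
    (α : E × F →L[ℝ] ℝ) : (B z).inverse α =
      ((b z.1).inverse (α ∘L inl ℝ E F), (c z.2).inverse (α ∘L inr ℝ E F)) := by
  refine h.prod.ext_apply hz fun u ↦ ?_
  rw [(h.prod.invertible z hz).self_apply_inverse, h.apply_eq z hz,
    (h.left.invertible _ hz.1).self_apply_inverse, (h.right.invertible _ hz.2).self_apply_inverse]
  simp [← map_add]

variable [FiniteDimensional ℝ E] [FiniteDimensional ℝ F]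

theorem fderiv_christoffelCLM (h : IsProductOn B b c S T) {z : E × F} (hz : z ∈ S ×ˢ T)
    (u v w : E × F) : fderiv ℝ (christoffelCLM B) z u v w =
      (fderiv ℝ (christoffelCLM b) z.1 u.1 v.1 w.1, fderiv ℝ (christoffelCLM c) z.2 u.2 v.2 w.2) := by
  have h1 := ((((h.prod.differentiableAt_christoffelCLM hz).hasFDerivAt.clm_apply
    (hasFDerivAt_const v z)).clm_apply (hasFDerivAt_const w z)))
  have h2 := ((((h.left.differentiableAt_christoffelCLM hz.1).hasFDerivAt.comp z
    hasFDerivAt_fst).clm_apply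
    (hasFDerivAt_const v.1 z)).clm_apply (hasFDerivAt_const w.1 z)).prodMk
    ((((h.right.differentiableAt_christoffelCLM hz.2).hasFDerivAt.comp z hasFDerivAt_snd).clm_apply
    (hasFDerivAt_const v.2 z)).clm_apply (hasFDerivAt_const w.2 z))
  have heq : (fun z ↦ christoffelCLM B z v w) =ᶠ[𝓝 z]
      fun z ↦ (christoffelCLM b z.1 v.1 w.1, christoffelCLM c z.2 v.2 w.2) := by
    filter_upwards [h.prod.isOpen.mem_nhds hz] with x hx using h.christoffel_eq hx v w
  have := congrArg (fun L ↦ L u) (h1.unique (h2.congr_of_eventuallyEq heq))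
  simpa using this

theorem curvatureTensor_eq (h : IsProductOn B b c S T) {z : E × F} (hz : z ∈ S ×ˢ T)
    (u v w : E × F) : curvatureTensor B z u v w =
      (curvatureTensor b z.1 u.1 v.1 w.1, curvatureTensor c z.2 u.2 v.2 w.2) := by
  have hc (v w : E × F) : christoffelCLM B z v w =
      (christoffelCLM b z.1 v.1 w.1, christoffelCLM c z.2 v.2 w.2) := h.christoffel_eq hz v w
  rw [h.prod.curvatureTensor_eq hz, h.left.curvatureTensor_eq hz.1,
    h.right.curvatureTensor_eq hz.2]
  simp only [hc, h.fderiv_christoffelCLM hz]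
  rfl

/-- The scalar curvature of a product is the sum of the scalar curvatures. -/
theorem scalarCurvatureAt_eq (h : IsProductOn B b c S T) {z : E × F} (hz : z ∈ S ×ˢ T) :
    scalarCurvatureAt B z = scalarCurvatureAt b z.1 + scalarCurvatureAt c z.2 := by
  set d := Module.finBasis ℝ E
  set e := Module.finBasis ℝ F
  have hl (i) (x : E × F) : coordL (d.prod e) (Sum.inl i) x = coordL d i x.1 := by
    simp [coordL_apply]
  have hr (i) (x : E × F) : coordL (d.prod e) (Sum.inr i) x = coordL e i x.2 := by
    simp [coordL_apply]
  have hll (i) : coordL (d.prod e) (Sum.inl i) ∘L inl ℝ E F = coordL d i := by ext; simp [hl]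
  have hlr (i) : coordL (d.prod e) (Sum.inl i) ∘L inr ℝ E F = 0 := by ext; simp [hl]
  have hrr (i) : coordL (d.prod e) (Sum.inr i) ∘L inr ℝ E F = coordL e i := by ext; simp [hr]
  have hrl (i) : coordL (d.prod e) (Sum.inr i) ∘L inl ℝ E F = 0 := by ext; simp [hr]
  have hz1 (v w : E) : curvatureTensor b z.1 0 v w = 0 := by
    rw [h.left.curvatureTensor_eq hz.1]; simp
  have hz2 (v w : F) : curvatureTensor c z.2 0 v w = 0 := by
    rw [h.right.curvatureTensor_eq hz.2]; simp
  -- In the product basis, a mixed term of the trace pairs a covector raised in one factor with the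
  -- curvature of the other, whose last argument is then zero. Only the two diagonal blocks survive.
  have hw1 (u v : E) : curvatureTensor b z.1 u v 0 = 0 := by
    rw [h.left.curvatureTensor_eq hz.1]; simp
  have hw2 (u v : F) : curvatureTensor c z.2 u v 0 = 0 := by
    rw [h.right.curvatureTensor_eq hz.2]; simp
  rw [h.prod.scalarCurvatureAt_eq hz (d.prod e), h.left.scalarCurvatureAt_eq hz.1 d,
    h.right.scalarCurvatureAt_eq hz.2 e]
  simp only [Fintype.sum_sum_type, h.curvatureTensor_eq hz, h.inverse_apply hz, hl, hr, hll, hlr,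
    hrr, hrl, Module.Basis.prod_apply_inl_fst, Module.Basis.prod_apply_inl_snd,
    Module.Basis.prod_apply_inr_fst, Module.Basis.prod_apply_inr_snd, hz1, hz2, hw1, hw2, map_zero,
    Finset.sum_const_zero, add_zero, zero_add]

end IsProductOn

end Product

/-! ### Metrics in charts: smoothness, change of charts, products -/

section MetricInChart

set_option maxSynthPendingDepth 3
set_option linter.unusedSectionVars false

variable {E : Type*} [NormedAddCommGroup E] [NormedSpace ℝ E] [FiniteDimensional ℝ E]
  {H : Type*} [TopologicalSpace H] {I : ModelWithCorners ℝ E H}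
  {M : Type*} [TopologicalSpace M] [ChartedSpace H M] [IsManifold I ∞ M]
  {E' : Type*} [NormedAddCommGroup E'] [NormedSpace ℝ E'] [FiniteDimensional ℝ E']
  {H' : Type*} [TopologicalSpace H'] {I' : ModelWithCorners ℝ E' H'}
  {M' : Type*} [TopologicalSpace M'] [ChartedSpace H' M'] [IsManifold I' ∞ M']

/-- A positive definite form on a finite-dimensional space is invertible. -/
theorem isInvertible_of_pos (b : E →L[ℝ] E →L[ℝ] ℝ) (hb : ∀ v, v ≠ 0 → 0 < b v v) :
    b.IsInvertible := by
  have hinj : Function.Injective b := by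
    rw [injective_iff_map_eq_zero]
    intro v hv
    by_contra h
    have := hb v h
    simp [hv] at this
  have hdim : Module.finrank ℝ E = Module.finrank ℝ (E →L[ℝ] ℝ) := by
    rw [(LinearMap.toContinuousLinearMap (𝕜 := ℝ) (E := E) (F' := ℝ)).symm.finrank_eq]
    exact (Subspace.dual_finrank_eq (K := ℝ) (V := E)).symm
  exact ⟨(LinearEquiv.ofInjectiveOfFinrankEq (b : E →ₗ[ℝ] E →L[ℝ] ℝ) hinj
    hdim).toContinuousLinearEquiv, by ext; rfl⟩

theorem isInvertible_inner (g : SmoothMetric I M) (x : M) : (g.inner x).IsInvertible :=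
  isInvertible_of_pos (E := E) (g.inner x) (g.pos x)

variable [I.Boundaryless] [I'.Boundaryless]

theorem isInvertible_mfderiv_extChartAt_symm {x₀ : M} {y : E} (hy : y ∈ (extChartAt I x₀).target) :
    (mfderiv 𝓘(ℝ, E) I (extChartAt I x₀).symm y).IsInvertible := by
  have := isInvertible_mfderivWithin_extChartAt_symm (I := I) hy
  rwa [I.range_eq_univ, mfderivWithin_univ] at this

theorem contMDiffAt_extChartAt_symm {x₀ : M} {y : E} (hy : y ∈ (extChartAt I x₀).target) :
    ContMDiffAt 𝓘(ℝ, E) I ∞ (extChartAt I x₀).symm y :=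
  (contMDiffOn_extChartAt_symm x₀).contMDiffAt ((isOpen_extChartAt_target x₀).mem_nhds hy)

theorem metricInChart_pos (g : SmoothMetric I M) {x₀ : M} {y : E}
    (hy : y ∈ (extChartAt I x₀).target) {v : E} (hv : v ≠ 0) : 0 < metricInChart g x₀ y v v := by
  refine g.pos _ _ fun h ↦ hv ?_
  exact (isInvertible_mfderiv_extChartAt_symm hy).bijective.injective (h.trans (map_zero _).symm)

/-- Smoothness of `g` is a statement in the trivialization of the tangent bundle at `f y`, where `f`
is the inverse chart. Near `y` the derivative of `f`, read in that trivialization, is smooth.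
Composing the two, the trivialization and its inverse cancel. -/
theorem contDiffAt_metricInChart (g : SmoothMetric I M) {x₀ : M} {y : E}
    (hy : y ∈ (extChartAt I x₀).target) : ContDiffAt ℝ ∞ (metricInChart g x₀) y := by
  set f := (extChartAt I x₀).symm with hfdef
  have hf := contMDiffAt_extChartAt_symm hy
  have h1 : ContMDiffAt 𝓘(ℝ, E) 𝓘(ℝ, E →L[ℝ] E) ∞
      (inTangentCoordinates 𝓘(ℝ, E) I id f (mfderiv 𝓘(ℝ, E) I f) y) y :=
    hf.mfderiv_const (by simp)
  have h2 := ((contMDiffAt_hom_bundle _).1 (g.contMDiff (f y))).2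
  have h3 := h2.comp y hf
  rw [← contMDiffAt_iff_contDiffAt]
  refine ((h1.clm_precomp (F₃ := ℝ)).clm_comp (h3.clm_comp h1)).congr_of_eventuallyEq ?_
  have m2 : ∀ᶠ z in 𝓝 y, f z ∈ (trivializationAt E (TangentSpace I) (f y)).baseSet :=
    hf.continuousAt <| (trivializationAt E (TangentSpace I) (f y)).open_baseSet.mem_nhds
        (FiberBundle.mem_baseSet_trivializationAt' (f y))
  filter_upwards [m2] with z hz
  ext v w
  have hA (v : E) : (trivializationAt E (TangentSpace I) (f y)).symm (f z)
      (inTangentCoordinates 𝓘(ℝ, E) I id f (mfderiv 𝓘(ℝ, E) I f) y z v) =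
      mfderiv 𝓘(ℝ, E) I f z v := by
    have e1 : inTangentCoordinates 𝓘(ℝ, E) I id f (mfderiv 𝓘(ℝ, E) I f) y z v =
        (trivializationAt E (TangentSpace I) (f y)).continuousLinearMapAt ℝ (f z)
          (mfderiv 𝓘(ℝ, E) I f z
            ((trivializationAt E (TangentSpace 𝓘(ℝ, E)) y).symmL ℝ z v)) := rfl
    rw [e1, TangentBundle.symmL_model_space]
    rw [← Trivialization.symmL_apply (R := ℝ) _ hz]
    exact Trivialization.symmL_continuousLinearMapAt (R := ℝ) _ hz _
  refine Eq.trans ?_ (inCoordinates_apply_eq₂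
    (v := inTangentCoordinates 𝓘(ℝ, E) I id f (mfderiv 𝓘(ℝ, E) I f) y z v)
    (w := inTangentCoordinates 𝓘(ℝ, E) I id f (mfderiv 𝓘(ℝ, E) I f) y z w)
      hz hz (Set.mem_univ _)).symm
  rw [hA, hA]
  exact (LinearMap.congr_fun (Trivial.linearMapAt_trivialization ℝ M ℝ (f z)) _).symm

theorem isMetricOn_metricInChart (g : SmoothMetric I M) (x₀ : M) :
    IsMetricOn (metricInChart g x₀) (extChartAt I x₀).target where
  isOpen := isOpen_extChartAt_target x₀
  contDiffOn _ hy := (contDiffAt_metricInChart g hy).contDiffWithinAt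
  invertible _ hy := isInvertible_of_pos _ fun _ hv ↦ metricInChart_pos g hy hv
  symm _ _ _ _ := g.symm _ _ _

theorem IsMetricOn.mono {b : E → E →L[ℝ] E →L[ℝ] ℝ} {S T : Set E} (hb : IsMetricOn b S)
    (hT : IsOpen T) (h : T ⊆ S) : IsMetricOn b T where
  isOpen := hT
  contDiffOn := hb.contDiffOn.mono h
  invertible y hy := hb.invertible y (h hy)
  symm y hy := hb.symm y (h hy)

/-- The domain of the change of charts. -/
def chartOverlap (I : ModelWithCorners ℝ E H) (x₁ x₀ : M) : Set E :=
  (extChartAt I x₁).target ∩ (extChartAt I x₁).symm ⁻¹' (extChartAt I x₀).source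

theorem isOpen_chartOverlap (x₁ x₀ : M) : IsOpen (chartOverlap I x₁ x₀) :=
  (continuousOn_extChartAt_symm x₁).isOpen_inter_preimage (isOpen_extChartAt_target x₁)
    (isOpen_extChartAt_source x₀)

/-- The change of charts. -/
def chartChange (I : ModelWithCorners ℝ E H) (x₁ x₀ : M) : E → E :=
  extChartAt I x₀ ∘ (extChartAt I x₁).symm

theorem contDiffAt_chartChange {x₁ x₀ : M} {z : E} (hz : z ∈ chartOverlap I x₁ x₀) :
    ContDiffAt ℝ ∞ (chartChange I x₁ x₀) z := by
  rw [← contMDiffAt_iff_contDiffAt]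
  have h := contMDiffAt_extChartAt' (I := I) (n := ∞) (x := x₀)
    (x' := (extChartAt I x₁).symm z) (by simpa using hz.2)
  exact h.comp z (contMDiffAt_extChartAt_symm hz.1)

theorem fderiv_chartChange {x₁ x₀ : M} {z : E} (hz : z ∈ chartOverlap I x₁ x₀) :
    fderiv ℝ (chartChange I x₁ x₀) z =
      (mfderiv I 𝓘(ℝ, E) (extChartAt I x₀) ((extChartAt I x₁).symm z)) ∘L
        (mfderiv 𝓘(ℝ, E) I (extChartAt I x₁).symm z) := by
  rw [← mfderiv_eq_fderiv]
  have h := contMDiffAt_extChartAt' (I := I) (n := ∞) (x := x₀)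
    (x' := (extChartAt I x₁).symm z) (by simpa using hz.2)
  exact mfderiv_comp z (h.mdifferentiableAt (by simp))
    ((contMDiffAt_extChartAt_symm hz.1).mdifferentiableAt (by simp))

theorem metricInChart_mfderiv (g : SmoothMetric I M) {x₀ p : M}
    (hp : p ∈ (extChartAt I x₀).source) (v w : TangentSpace I p) :
    metricInChart g x₀ (extChartAt I x₀ p) (mfderiv I 𝓘(ℝ, E) (extChartAt I x₀) p v)
      (mfderiv I 𝓘(ℝ, E) (extChartAt I x₀) p w) = g.inner p v w := by
  have h := mfderivWithin_extChartAt_symm_comp_mfderiv_extChartAt' (I := I) hp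
  rw [I.range_eq_univ, mfderivWithin_univ] at h
  -- The point reached by going through the chart and back equals `p` only propositionally.
  -- Generalizing over the point and the vectors allows the substitution in the dependent type.
  have key : ∀ q : M, q = p → ∀ v' w' : E, v' = v → w' = w →
      (g.inner q : E →L[ℝ] E →L[ℝ] ℝ) v' w' = g.inner p v w := by
    rintro q rfl v' w' rfl rfl
    rfl
  exact key _ ((extChartAt I x₀).left_inv hp) _ _ (congrArg (fun L : E →L[ℝ] E ↦ L v) h)
    (congrArg (fun L : E →L[ℝ] E ↦ L w) h)

theorem isPullbackOn_chartChange (g : SmoothMetric I M) (x₁ x₀ : M) :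
    IsPullbackOn (chartChange I x₁ x₀) (metricInChart g x₁) (metricInChart g x₀)
      (chartOverlap I x₁ x₀) (extChartAt I x₀).target where
  source := (isMetricOn_metricInChart g x₁).mono (isOpen_chartOverlap x₁ x₀) Set.inter_subset_left
  target := isMetricOn_metricInChart g x₀
  contDiffOn _ hz := (contDiffAt_chartChange hz).contDiffWithinAt
  mapsTo _ hz := (extChartAt I x₀).map_source hz.2
  invertible z hz := by
    rw [fderiv_chartChange hz]
    exact (isInvertible_mfderiv_extChartAt hz.2).comp (isInvertible_mfderiv_extChartAt_symm hz.1)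
  apply_eq z hz v w := by
    rw [fderiv_chartChange hz]
    exact (metricInChart_mfderiv g hz.2 _ _).symm

/-- The scalar curvature can be computed in any chart. -/
theorem scalarCurvature_eq (g : SmoothMetric I M) {x₀ x : M} (hx : x ∈ (extChartAt I x₀).source) :
    scalarCurvature g x = scalarCurvatureAt (metricInChart g x₀) (extChartAt I x₀ x) := by
  have hz : extChartAt I x x ∈ chartOverlap I x x₀ :=
    ⟨mem_extChartAt_target x, by simpa using hx⟩
  have := (isPullbackOn_chartChange g x x₀).scalarCurvatureAt_eq hz
  rw [scalarCurvature, this, chartChange, Function.comp_apply, extChartAt_to_inv]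

/-- The definition uses a chart that changes with the point. Chart independence replaces it near `x`
by the single chart around `x`, where the curvature is continuous. -/
theorem continuous_scalarCurvature (g : SmoothMetric I M) : Continuous (scalarCurvature g) := by
  rw [continuous_iff_continuousAt]
  intro x
  have hs := extChartAt_source_mem_nhds (I := I) x
  have h1 : ContinuousAt (scalarCurvatureAt (metricInChart g x)) (extChartAt I x x) :=
    (isMetricOn_metricInChart g x).continuousOn_scalarCurvatureAt.continuousAt
      (extChartAt_target_mem_nhds x)
  refine (h1.comp (continuousAt_extChartAt x)).congr ?_
  filter_upwards [hs] with z hz using (scalarCurvature_eq g hz).symm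

/-- The norm of the differential in a chart. -/
theorem normSqDiff_eq (g : SmoothMetric I M) {u : M → ℝ} {x₀ x : M}
    (hx : x ∈ (extChartAt I x₀).source) (hu : MDifferentiableAt I 𝓘(ℝ, ℝ) u x) :
    normSqDiff g u x = fderiv ℝ (u ∘ (extChartAt I x₀).symm) (extChartAt I x₀ x)
      ((metricInChart g x₀ (extChartAt I x₀ x)).inverse
        (fderiv ℝ (u ∘ (extChartAt I x₀).symm) (extChartAt I x₀ x))) := by
  have hxt := (extChartAt I x₀).map_source hx
  set B : E →L[ℝ] E := mfderiv I 𝓘(ℝ, E) (extChartAt I x₀) x with hB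
  set L := fderiv ℝ (u ∘ (extChartAt I x₀).symm) (extChartAt I x₀ x) with hL
  have hD : (mvfderiv I u x : E →L[ℝ] ℝ) = L ∘L B := by
    have h0 : (u ∘ (extChartAt I x₀).symm) ∘ extChartAt I x₀ =ᶠ[𝓝 x] u := by
      filter_upwards [(isOpen_extChartAt_source x₀).mem_nhds hx] with z hz
      exact congrArg u ((extChartAt I x₀).left_inv hz)
    have h1 : MDifferentiableAt 𝓘(ℝ, E) 𝓘(ℝ, ℝ) (u ∘ (extChartAt I x₀).symm)
        (extChartAt I x₀ x) := by
      refine MDifferentiableAt.comp (I' := I) _ ?_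
        ((contMDiffAt_extChartAt_symm hxt).mdifferentiableAt (by simp))
      rwa [(extChartAt I x₀).left_inv hx]
    have h2 : MDifferentiableAt I 𝓘(ℝ, E) (extChartAt I x₀) x :=
      mdifferentiableAt_extChartAt (by simpa using hx)
    have h3 := mfderiv_comp x h1 h2
    rw [h0.mfderiv_eq, mfderiv_eq_fderiv] at h3
    exact h3
  have hBinv : B.IsInvertible := isInvertible_mfderiv_extChartAt hx
  set b := metricInChart g x₀ (extChartAt I x₀ x) with hb
  have hbinv : b.IsInvertible := (isMetricOn_metricInChart g x₀).invertible _ hxt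
  have key : B ((g.inner x).inverse (mvfderiv I u x)) = b.inverse L := by
    refine (isMetricOn_metricInChart g x₀).ext_apply hxt fun w ↦ ?_
    obtain ⟨w, rfl⟩ := hBinv.bijective.surjective w
    refine (metricInChart_mfderiv g hx _ _).trans ?_
    rw [(isInvertible_inner g x).self_apply_inverse, ← hb, hbinv.self_apply_inverse]
    exact congrArg (fun L : E →L[ℝ] ℝ ↦ L w) hD
  rw [normSqDiff, ← key]
  exact congrArg (fun L : E →L[ℝ] ℝ ↦ L ((g.inner x).inverse (mvfderiv I u x))) hD

theorem continuous_normSqDiff (g : SmoothMetric I M) {u : M → ℝ} (hu : ContMDiff I 𝓘(ℝ, ℝ) ∞ u) :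
    Continuous (normSqDiff g u) := by
  rw [continuous_iff_continuousAt]
  intro x
  have hs := extChartAt_source_mem_nhds (I := I) x
  have hxt := mem_extChartAt_target (I := I) x
  have hf : ContDiffAt ℝ ∞ (u ∘ (extChartAt I x).symm) (extChartAt I x x) := by
    rw [← contMDiffAt_iff_contDiffAt]
    exact hu.contMDiffAt.comp _ (contMDiffAt_extChartAt_symm hxt)
  have h1 : ContinuousAt (fderiv ℝ (u ∘ (extChartAt I x).symm)) (extChartAt I x x) :=
    (hf.fderiv_right (m := ∞) (by simp)).continuousAt
  have h2 := ((isMetricOn_metricInChart g x).contDiffAt_inverse hxt).continuousAt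
  have h3 := (h1.clm_apply (h2.clm_apply h1)).comp (continuousAt_extChartAt (I := I) x)
  refine h3.congr ?_
  filter_upwards [hs] with z hz
    using (normSqDiff_eq g hz (hu.mdifferentiableAt (by simp))).symm

/-! ### Products -/

theorem extChartAt_prod_symm_apply (x₀ : M × M') (z : E × E') :
    (extChartAt (I.prod I') x₀).symm z =
      ((extChartAt I x₀.1).symm z.1, (extChartAt I' x₀.2).symm z.2) := by
  rw [extChartAt_prod]; rfl

theorem extChartAt_prod_target (x₀ : M × M') : (extChartAt (I.prod I') x₀).target =
    (extChartAt I x₀.1).target ×ˢ (extChartAt I' x₀.2).target := by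
  rw [extChartAt_prod]; rfl

theorem extChartAt_prod_source (x₀ : M × M') : (extChartAt (I.prod I') x₀).source =
    (extChartAt I x₀.1).source ×ˢ (extChartAt I' x₀.2).source := by
  rw [extChartAt_prod]; rfl

theorem metricInChart_prodMetric (g : SmoothMetric I M) (h : SmoothMetric I' M') (x₀ : M × M')
    {z : E × E'} (hz : z ∈ (extChartAt I x₀.1).target ×ˢ (extChartAt I' x₀.2).target)
    (v w : E × E') :
    metricInChart (prodMetric g h) x₀ z v w =
      metricInChart g x₀.1 z.1 v.1 w.1 + metricInChart h x₀.2 z.2 v.2 w.2 := by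
  have h1 : ((extChartAt (I.prod I') x₀).symm : E × E' → M × M') =
      Prod.map (extChartAt I x₀.1).symm (extChartAt I' x₀.2).symm :=
    funext fun z ↦ extChartAt_prod_symm_apply x₀ z
  have h2 := mfderiv_prodMap (p := z)
    ((contMDiffAt_extChartAt_symm (I := I) hz.1).mdifferentiableAt (by simp))
    ((contMDiffAt_extChartAt_symm (I := I') hz.2).mdifferentiableAt (by simp))
  rw [← modelWithCornersSelf_prod, chartedSpaceSelf_prod, ← h1] at h2
  have key : ∀ q : M × M', q = ((extChartAt I x₀.1).symm z.1, (extChartAt I' x₀.2).symm z.2) →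
      ∀ A : E × E' →L[ℝ] E × E', A = ContinuousLinearMap.prodMap
        (mfderiv 𝓘(ℝ, E) I (extChartAt I x₀.1).symm z.1 : E →L[ℝ] E)
        (mfderiv 𝓘(ℝ, E') I' (extChartAt I' x₀.2).symm z.2 : E' →L[ℝ] E') →
      ((prodMetric g h).inner q : E × E' →L[ℝ] E × E' →L[ℝ] ℝ) (A v) (A w) =
      metricInChart g x₀.1 z.1 v.1 w.1 + metricInChart h x₀.2 z.2 v.2 w.2 := by
    rintro q rfl A rfl
    exact prodForm_apply g h _ _ _
  exact key _ (extChartAt_prod_symm_apply x₀ z) _ h2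

theorem isProductOn_metricInChart (g : SmoothMetric I M) (h : SmoothMetric I' M') (x₀ : M × M') :
    IsProductOn (metricInChart (prodMetric g h) x₀) (metricInChart g x₀.1)
      (metricInChart h x₀.2) (extChartAt I x₀.1).target (extChartAt I' x₀.2).target where
  prod := by
    have := isMetricOn_metricInChart (prodMetric g h) x₀
    rwa [extChartAt_prod_target] at this
  left := isMetricOn_metricInChart g x₀.1
  right := isMetricOn_metricInChart h x₀.2
  apply_eq _ hz := metricInChart_prodMetric g h x₀ hz

/-- The preferred chart at a point of the product is the product of the preferred charts, so the
coordinate formula applies without a change of charts. -/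
theorem scalarCurvature_prodMetric (g : SmoothMetric I M) (h : SmoothMetric I' M') (x : M × M') :
    scalarCurvature (prodMetric g h) x = scalarCurvature g x.1 + scalarCurvature h x.2 := by
  have hx : extChartAt (I.prod I') x x = (extChartAt I x.1 x.1, extChartAt I' x.2 x.2) := by
    rw [extChartAt_prod]; rfl
  rw [scalarCurvature, hx]
  exact (isProductOn_metricInChart g h x).scalarCurvatureAt_eq
    ⟨mem_extChartAt_target x.1, mem_extChartAt_target x.2⟩

/-- The differential restricts on the factors to the differentials of the two slices. The metric is
block diagonal, so the gradient is the pair of the gradients of the slices. -/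
theorem normSqDiff_prodMetric (g : SmoothMetric I M) (h : SmoothMetric I' M') {u : M × M' → ℝ}
    {x : M × M'} (hu : MDifferentiableAt (I.prod I') 𝓘(ℝ, ℝ) u x) :
    normSqDiff (prodMetric g h) u x =
      normSqDiff g (fun p ↦ u (p, x.2)) x.1 + normSqDiff h (fun q ↦ u (x.1, q)) x.2 := by
  set D : E × E' →L[ℝ] ℝ := mvfderiv (I.prod I') u x with hD
  have h1 : (mvfderiv I (fun p ↦ u (p, x.2)) x.1 : E →L[ℝ] ℝ) =
      D ∘L ContinuousLinearMap.inl ℝ E E' := by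
    have := mvfderiv_comp (I := I.prod I') (I' := I) (f := fun p ↦ (p, x.2)) x.1 hu
      (mdifferentiableAt_id.prodMk mdifferentiableAt_const)
    rw [mfderiv_prod_left] at this
    exact this
  have h2 : (mvfderiv I' (fun q ↦ u (x.1, q)) x.2 : E' →L[ℝ] ℝ) =
      D ∘L ContinuousLinearMap.inr ℝ E E' := by
    have := mvfderiv_comp (I := I.prod I') (I' := I') (f := fun q ↦ (x.1, q)) x.2 hu
      (mdifferentiableAt_const.prodMk mdifferentiableAt_id)
    rw [mfderiv_prod_right] at this
    exact this
  set p : E := (g.inner x.1).inverse (mvfderiv I (fun p ↦ u (p, x.2)) x.1) with hp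
  set q : E' := (h.inner x.2).inverse (mvfderiv I' (fun q ↦ u (x.1, q)) x.2) with hq
  have hinv : (((prodMetric g h).inner x).inverse D : E × E') = (p, q) := by
    have hG := isInvertible_inner (prodMetric g h) x
    refine hG.bijective.injective ?_
    refine (hG.self_apply_inverse _).trans ?_
    refine ContinuousLinearMap.ext fun w ↦ ?_
    refine Eq.trans ?_ (prodForm_apply g h x (p, q) w).symm
    have e1 : g.inner x.1 p = mvfderiv I (fun p ↦ u (p, x.2)) x.1 :=
      (isInvertible_inner g x.1).self_apply_inverse _
    have e2 : h.inner x.2 q = mvfderiv I' (fun q ↦ u (x.1, q)) x.2 :=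
      (isInvertible_inner h x.2).self_apply_inverse _
    have e1' := congrArg (fun L : E →L[ℝ] ℝ ↦ L w.1) (e1.trans h1)
    have e2' := congrArg (fun L : E' →L[ℝ] ℝ ↦ L w.2) (e2.trans h2)
    refine Eq.trans ?_ (congrArg₂ (· + ·) e1' e2').symm
    simp [← map_add]
  have h1' := congrArg (fun L : E →L[ℝ] ℝ ↦ L p) h1
  have h2' := congrArg (fun L : E' →L[ℝ] ℝ ↦ L q) h2
  refine Eq.trans ?_ (congrArg₂ (· + ·) h1' h2').symm
  refine (congrArg D hinv).trans ?_
  simp [← map_add]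

end MetricInChart

/-! ### Gram determinants and the volume density -/

section Gram

set_option maxSynthPendingDepth 3

variable {E : Type*} [NormedAddCommGroup E] [NormedSpace ℝ E]
  {ι κ : Type*} [Fintype ι] [DecidableEq ι] [Fintype κ] [DecidableEq κ]

/-- The Gram matrix of a bilinear form in a basis. -/
def gramMatrix (c : Module.Basis ι ℝ E) (b : E →L[ℝ] E →L[ℝ] ℝ) : Matrix ι ι ℝ :=
  Matrix.of fun i j ↦ b (c i) (c j)

theorem gramMatrix_eq (c : Module.Basis ι ℝ E) (b : E →L[ℝ] E →L[ℝ] ℝ) :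
    gramMatrix c b = LinearMap.BilinForm.toMatrix c b.toBilinForm := by
  ext i j
  rw [LinearMap.BilinForm.toMatrix_apply]
  rfl

theorem det_gramMatrix_comp (c : Module.Basis ι ℝ E) (b b' : E →L[ℝ] E →L[ℝ] ℝ) (A : E →L[ℝ] E)
    (h : ∀ v w, b' v w = b (A v) (A w)) :
    (gramMatrix c b').det = A.det ^ 2 * (gramMatrix c b).det := by
  have hb : b'.toBilinForm = b.toBilinForm.comp (A : E →ₗ[ℝ] E) (A : E →ₗ[ℝ] E) := by
    ext v w; exact h v w
  rw [gramMatrix_eq, gramMatrix_eq, hb, LinearMap.BilinForm.toMatrix_comp c c, Matrix.det_mul,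
    Matrix.det_mul, Matrix.det_transpose, LinearMap.det_toMatrix]
  change _ = (LinearMap.det (A : E →ₗ[ℝ] E)) ^ 2 * _
  ring

theorem det_gramMatrix_basis (c d : Module.Basis ι ℝ E) (b : E →L[ℝ] E →L[ℝ] ℝ) :
    (gramMatrix d b).det = (c.det d) ^ 2 * (gramMatrix c b).det := by
  rw [gramMatrix_eq, gramMatrix_eq, ← LinearMap.BilinForm.toMatrix_mul_basis_toMatrix c d,
    Matrix.det_mul, Matrix.det_mul, Matrix.det_transpose, Module.Basis.det_apply]
  ring

theorem det_gramMatrix_reindex (c : Module.Basis ι ℝ E) (e : ι ≃ κ) (b : E →L[ℝ] E →L[ℝ] ℝ) :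
    (gramMatrix (c.reindex e) b).det = (gramMatrix c b).det := by
  rw [← Matrix.det_submatrix_equiv_self e.symm (gramMatrix c b)]
  congr 1
  ext i j
  simp [gramMatrix]

theorem det_gramMatrix_pos (c : Module.Basis ι ℝ E) (b : E →L[ℝ] E →L[ℝ] ℝ)
    (hs : ∀ v w, b v w = b w v) (hb : ∀ v, v ≠ 0 → 0 < b v v) : 0 < (gramMatrix c b).det := by
  refine (Matrix.PosDef.of_dotProduct_mulVec_pos ?_ fun x hx ↦ ?_).det_pos
  · ext i j
    simp [gramMatrix, hs (c j)]
  · rw [gramMatrix_eq, star_trivial, LinearMap.BilinForm.dotProduct_toMatrix_mulVec]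
    exact hb _ ((map_ne_zero_iff _ c.equivFun.symm.injective).2 hx)

/-- The Riemannian volume density with respect to the Haar measure of a basis. -/
def volumeDensity (c : Module.Basis ι ℝ E) (b : E →L[ℝ] E →L[ℝ] ℝ) : ℝ :=
  √(gramMatrix c b).det

theorem volumeDensity_comp (c : Module.Basis ι ℝ E) (b b' : E →L[ℝ] E →L[ℝ] ℝ) (A : E →L[ℝ] E)
    (h : ∀ v w, b' v w = b (A v) (A w)) :
    volumeDensity c b' = |A.det| * volumeDensity c b := by
  rw [volumeDensity, det_gramMatrix_comp c b b' A h, Real.sqrt_mul (sq_nonneg _),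
    Real.sqrt_sq_eq_abs, volumeDensity]

theorem continuousOn_volumeDensity (c : Module.Basis ι ℝ E) {b : E → E →L[ℝ] E →L[ℝ] ℝ}
    {S : Set E} (hb : ContinuousOn b S) : ContinuousOn (fun y ↦ volumeDensity c (b y)) S := by
  refine Real.continuous_sqrt.comp_continuousOn ?_
  simp only [Matrix.det_apply]
  refine continuousOn_finsetSum _ fun σ _ ↦ ContinuousOn.const_smul (continuousOn_finsetProd _ fun i _ ↦ ?_) _
  change ContinuousOn (fun y ↦ b y (c (σ i)) (c i)) S
  fun_prop

variable [FiniteDimensional ℝ E] [MeasurableSpace E] [BorelSpace E]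

theorem addHaar_eq_smul (c d : Module.Basis ι ℝ E) :
    c.addHaar = ENNReal.ofReal |c.det d| • d.addHaar := by
  have h := Measure.addHaarMeasure_unique c.addHaar d.parallelepiped
  rw [← Module.Basis.addHaar_def] at h
  rw [← Measure.addHaar_parallelepiped c d]
  exact h

/-- The volume element does not depend on the basis. -/
theorem setLIntegral_volumeDensity (c : Module.Basis ι ℝ E) (d : Module.Basis κ ℝ E)
    (b : E → E →L[ℝ] E →L[ℝ] ℝ) (S : Set E) :
    ∫⁻ y in S, ENNReal.ofReal (volumeDensity c (b y)) ∂c.addHaar =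
      ∫⁻ y in S, ENNReal.ofReal (volumeDensity d (b y)) ∂d.addHaar := by
  obtain ⟨e⟩ : Nonempty (κ ≃ ι) := ⟨d.indexEquiv c⟩
  set d' := d.reindex e
  -- The same factor `|c.det d'|` relates `c.addHaar` to `d'.addHaar`, so density times Haar measure
  -- is unchanged.
  have h1 (y : E) : volumeDensity d (b y) = |c.det d'| * volumeDensity c (b y) := by
    rw [volumeDensity, ← det_gramMatrix_reindex d e, det_gramMatrix_basis c,
      Real.sqrt_mul (sq_nonneg _), Real.sqrt_sq_eq_abs, volumeDensity]
  rw [← d.addHaar_reindex e, addHaar_eq_smul c d', Measure.restrict_smul, lintegral_smul_measure]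
  simp_rw [h1, ENNReal.ofReal_mul (abs_nonneg _)]
  rw [lintegral_const_mul' _ _ ENNReal.ofReal_ne_top]
  rfl

end Gram

/-! ### The Riemannian volume measure: gluing of the chart volumes -/

section Volume

set_option maxSynthPendingDepth 3
set_option linter.unusedSectionVars false

variable {E : Type*} [NormedAddCommGroup E] [NormedSpace ℝ E] [FiniteDimensional ℝ E]
  [MeasurableSpace E] [BorelSpace E]
  {H : Type*} [TopologicalSpace H] {I : ModelWithCorners ℝ E H} [I.Boundaryless]
  {M : Type*} [TopologicalSpace M] [ChartedSpace H M] [IsManifold I ∞ M]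
  [MeasurableSpace M] [BorelSpace M]

theorem continuousOn_metricInChart (g : SmoothMetric I M) (x₀ : M) :
    ContinuousOn (metricInChart g x₀) (extChartAt I x₀).target :=
  (isMetricOn_metricInChart g x₀).contDiffOn.continuousOn

theorem det_gramMatrix_metricInChart_pos {ι : Type*} [Fintype ι] [DecidableEq ι]
    (c : Module.Basis ι ℝ E) (g : SmoothMetric I M) {x₀ : M} {y : E}
    (hy : y ∈ (extChartAt I x₀).target) : 0 < (gramMatrix c (metricInChart g x₀ y)).det :=
  det_gramMatrix_pos _ _ (fun _ _ ↦ g.symm _ _ _) fun _ hv ↦ metricInChart_pos g hy hv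

theorem aemeasurable_volumeDensity {ι : Type*} [Fintype ι] [DecidableEq ι]
    (c : Module.Basis ι ℝ E) (g : SmoothMetric I M) {x₀ : M} {μ : Measure E} {P : Set E}
    (hP : MeasurableSet P) (hPT : P ⊆ (extChartAt I x₀).target) :
    AEMeasurable (fun y ↦ ENNReal.ofReal (volumeDensity c (metricInChart g x₀ y)))
      (μ.restrict P) :=
  (((continuousOn_volumeDensity _ (continuousOn_metricInChart g x₀)).mono hPT).aemeasurable
    hP).ennreal_ofReal

theorem chartVolume_apply (g : SmoothMetric I M) (x₀ : M) {s : Set M} (hs : MeasurableSet s) :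
    chartVolume g x₀ s = ∫⁻ y in (extChartAt I x₀).target ∩ (extChartAt I x₀).symm ⁻¹' s,
      ENNReal.ofReal (volumeDensity (Module.finBasis ℝ E) (metricInChart g x₀ y))
        ∂(Module.finBasis ℝ E).addHaar := by
  have hT : MeasurableSet (extChartAt I x₀).target := (isOpen_extChartAt_target x₀).measurableSet
  -- The inverse chart is controlled only on the target of the chart, hence almost everywhere
  -- measurability for the restricted measure.
  rw [chartVolume, Measure.map_apply_of_aemeasurable
    (((continuousOn_extChartAt_symm x₀).aemeasurable hT).mono_ac
      (withDensity_absolutelyContinuous _ _)) hs,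
    withDensity_apply', Measure.restrict_restrict' hT, Set.inter_comm]
  rfl

theorem measurableSet_target_inter (x₀ : M) {s : Set M} (hs : MeasurableSet s) :
    MeasurableSet ((extChartAt I x₀).target ∩ (extChartAt I x₀).symm ⁻¹' s) := by
  have h := (continuousOn_iff_continuous_domRestrict.1
    (continuousOn_extChartAt_symm (I := I) x₀)).measurable hs
  have := (isOpen_extChartAt_target (I := I) x₀).measurableSet.subtype_image h
  rwa [Set.domRestrict_eq, Set.preimage_comp, Subtype.image_preimage_coe] at this

theorem measurableSet_source (x₀ : M) : MeasurableSet (extChartAt I x₀).source :=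
  (isOpen_extChartAt_source x₀).measurableSet

/-- Change of variables: the Jacobian `|det A|` of the change of charts is exactly the factor by
which the density `√det` of the pulled back form changes. -/
theorem chartVolume_eq_of_subset (g : SmoothMetric I M) {x₀ x₁ : M} {s : Set M}
    (hs : MeasurableSet s) (h₀ : s ⊆ (extChartAt I x₀).source) (h₁ : s ⊆ (extChartAt I x₁).source) :
    chartVolume g x₁ s = chartVolume g x₀ s := by
  set P := (extChartAt I x₁).target ∩ (extChartAt I x₁).symm ⁻¹' s with hP
  have hPo : P ⊆ chartOverlap I x₁ x₀ := fun z hz ↦ ⟨hz.1, h₀ hz.2⟩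
  have himg : chartChange I x₁ x₀ '' P =
      (extChartAt I x₀).target ∩ (extChartAt I x₀).symm ⁻¹' s := by
    ext y
    constructor
    · rintro ⟨z, hz, rfl⟩
      exact ⟨(extChartAt I x₀).map_source (h₀ hz.2), by
        simpa only [chartChange, Function.comp_apply, Set.mem_preimage,
          (extChartAt I x₀).left_inv (h₀ hz.2)] using hz.2⟩
    · rintro ⟨hy, hys⟩
      refine ⟨extChartAt I x₁ ((extChartAt I x₀).symm y),
        ⟨(extChartAt I x₁).map_source (h₁ hys), ?_⟩, ?_⟩
      · simpa only [Set.mem_preimage, (extChartAt I x₁).left_inv (h₁ hys)] using hys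
      · simp only [chartChange, Function.comp_apply, (extChartAt I x₁).left_inv (h₁ hys),
          (extChartAt I x₀).right_inv hy]
  have hinj : Set.InjOn (chartChange I x₁ x₀) P := fun z hz z' hz' h ↦
    (extChartAt I x₁).symm.injOn hz.1 hz'.1 ((extChartAt I x₀).injOn (h₀ hz.2) (h₀ hz'.2) h)
  have hpull := isPullbackOn_chartChange g x₁ x₀
  have hPm := measurableSet_target_inter (I := I) x₁ hs
  rw [chartVolume_apply g x₁ hs, chartVolume_apply g x₀ hs, ← himg,
    lintegral_image_eq_lintegral_abs_det_fderiv_mul _ hPm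
      (fun z hz ↦ (hpull.hasFDerivAt (hPo hz)).hasFDerivWithinAt) hinj]
  refine setLIntegral_congr_fun hPm fun z hz ↦ ?_
  rw [volumeDensity_comp _ _ _ _ (hpull.apply_eq z (hPo hz)), ENNReal.ofReal_mul (abs_nonneg _)]

theorem chartVolume_inter_source (g : SmoothMetric I M) (x₀ : M) {s : Set M}
    (hs : MeasurableSet s) :
    chartVolume g x₀ (s ∩ (extChartAt I x₀).source) = chartVolume g x₀ s := by
  rw [chartVolume_apply g x₀ hs, chartVolume_apply g x₀ (hs.inter (measurableSet_source x₀))]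
  congr 2
  ext y
  constructor
  · exact fun h ↦ ⟨h.1, h.2.1⟩
  · exact fun h ↦ ⟨h.1, h.2, (extChartAt I x₀).map_target h.1⟩

theorem chartVolume_restrict_source (g : SmoothMetric I M) (x₀ : M) :
    (chartVolume g x₀).restrict (extChartAt I x₀).source = chartVolume g x₀ := by
  ext s hs
  rw [Measure.restrict_apply hs, chartVolume_inter_source g x₀ hs]

theorem chartVolume_restrict_comm (g : SmoothMetric I M) (x₀ x₁ : M) :
    (chartVolume g x₀).restrict (extChartAt I x₁).source =
      (chartVolume g x₁).restrict (extChartAt I x₀).source := by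
  ext s hs
  rw [Measure.restrict_apply hs, Measure.restrict_apply hs,
    ← chartVolume_inter_source g x₀ (hs.inter (measurableSet_source x₁)),
    ← chartVolume_inter_source g x₁ (hs.inter (measurableSet_source x₀)),
    Set.inter_right_comm]
  exact chartVolume_eq_of_subset g ((hs.inter (measurableSet_source x₀)).inter
    (measurableSet_source x₁)) Set.inter_subset_right
    (Set.inter_subset_left.trans Set.inter_subset_right)

variable (I M) in
theorem exists_seq_iUnion_source_eq_univ [SecondCountableTopology M] [Nonempty M] :
    ∃ x : ℕ → M, ⋃ n, (extChartAt I (x n)).source = Set.univ := by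
  obtain ⟨S, hS, hU⟩ := TopologicalSpace.countable_cover_nhds
    (fun x : M ↦ extChartAt_source_mem_nhds (I := I) x)
  have hne : S.Nonempty := by
    by_contra h
    rw [Set.not_nonempty_iff_eq_empty] at h
    subst h
    simp only [Set.mem_empty_iff_false, Set.iUnion_of_empty, Set.iUnion_empty] at hU
    exact Set.empty_ne_univ hU
  obtain ⟨x, rfl⟩ := hS.exists_eq_range hne
  exact ⟨x, by simpa using hU⟩

/-- On the domain of a chart, the volume measure is the one given by the chart. -/
theorem riemannianVolume_restrict_source [SecondCountableTopology M] (g : SmoothMetric I M)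
    (x₀ : M) : (riemannianVolume g).restrict (extChartAt I x₀).source = chartVolume g x₀ := by
  have : Nonempty M := ⟨x₀⟩
  obtain ⟨x, hx⟩ := exists_seq_iUnion_source_eq_univ I M
  set S := disjointed fun n ↦ (extChartAt I (x n)).source with hS
  have hSm (n : ℕ) : MeasurableSet (S n) := MeasurableSet.disjointed
    (fun n ↦ measurableSet_source (x n)) n
  have hSU : ⋃ n, S n = Set.univ := by rw [hS, iUnion_disjointed, hx]
  -- Cut a countable cover by chart domains into disjoint pieces and use one chart volume on each.
  -- Agreement on overlaps shows that `ν` restricts to every chart volume, so `ν` dominates the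
  -- supremum.
  set ν : Measure M := Measure.sum fun n ↦ (chartVolume g (x n)).restrict (S n) with hν
  have key (y : M) : ν.restrict (extChartAt I y).source = chartVolume g y := by
    rw [hν, Measure.restrict_sum _ (measurableSet_source y)]
    conv_rhs => rw [← Measure.restrict_univ (μ := chartVolume g y), ← hSU,
      Measure.restrict_iUnion (disjoint_disjointed _) hSm]
    congr 1
    ext1 n
    have h1 : S n ⊆ (extChartAt I (x n)).source := disjointed_subset _ n
    have h2 : (chartVolume g y).restrict (S n) =
        ((chartVolume g y).restrict (extChartAt I (x n)).source).restrict (S n) := by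
      rw [Measure.restrict_restrict (hSm n), Set.inter_eq_left.2 h1]
    rw [h2, chartVolume_restrict_comm g y (x n), Measure.restrict_comm (hSm n)]
  have hle : riemannianVolume g ≤ ν := iSup_le fun y ↦ (key y).symm.trans_le Measure.restrict_le_self
  refine le_antisymm ?_ ?_
  · rw [← key x₀]
    exact Measure.restrict_mono le_rfl hle
  · rw [← chartVolume_restrict_source g x₀]
    exact Measure.restrict_mono le_rfl (le_iSup (chartVolume g) x₀)

theorem riemannianVolume_apply [SecondCountableTopology M] (g : SmoothMetric I M)
    {x₀ : M} {s : Set M} (hs : MeasurableSet s) (h : s ⊆ (extChartAt I x₀).source) :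
    riemannianVolume g s = chartVolume g x₀ s := by
  rw [← riemannianVolume_restrict_source g x₀, Measure.restrict_apply hs, Set.inter_eq_left.2 h]

/-- The density is continuous, hence integrable on compact subsets of a chart. This makes continuous
functions of compact support integrable and, by second countability, the measure σ-finite, as needed
for Fubini. -/
instance isLocallyFiniteMeasure_riemannianVolume [SecondCountableTopology M]
    (g : SmoothMetric I M) : IsLocallyFiniteMeasure (riemannianVolume g) := by
  refine ⟨fun x ↦ ?_⟩
  obtain ⟨K, hK, hxK, hKT⟩ := exists_compact_subset (isOpen_extChartAt_target (I := I) x)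
    (mem_extChartAt_target x)
  have hso : IsOpen ((extChartAt I x).source ∩ extChartAt I x ⁻¹' interior K) :=
    (continuousOn_extChartAt x).isOpen_inter_preimage (isOpen_extChartAt_source x) isOpen_interior
  refine ⟨_, hso.mem_nhds ⟨mem_extChartAt_source x, hxK⟩, ?_⟩
  rw [riemannianVolume_apply g hso.measurableSet Set.inter_subset_left,
    chartVolume_apply g x hso.measurableSet]
  have hint : IntegrableOn (fun y ↦ volumeDensity (Module.finBasis ℝ E) (metricInChart g x y)) K
      (Module.finBasis ℝ E).addHaar :=
    ((continuousOn_volumeDensity _ (continuousOn_metricInChart g x)).mono hKT).integrableOn_compact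
      hK
  refine (lintegral_mono_set fun y hy ↦ ?_).trans_lt hint.lintegral_lt_top
  have := hy.2.2
  rw [Set.mem_preimage, (extChartAt I x).right_inv hy.1] at this
  exact interior_subset this

/-- The density is strictly positive in every chart. This is what makes the denominator of the
Yamabe functional positive on test functions. -/
instance isOpenPosMeasure_riemannianVolume [SecondCountableTopology M]
    (g : SmoothMetric I M) : (riemannianVolume g).IsOpenPosMeasure := by
  refine ⟨fun U hU ⟨x, hx⟩ h0 ↦ ?_⟩
  have hU' : IsOpen (U ∩ (extChartAt I x).source) := hU.inter (isOpen_extChartAt_source x)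
  have h1 := measure_mono_null (Set.inter_subset_left (t := (extChartAt I x).source)) h0
  rw [riemannianVolume_apply g hU'.measurableSet Set.inter_subset_right,
    chartVolume_apply g x hU'.measurableSet] at h1
  set P := (extChartAt I x).target ∩ (extChartAt I x).symm ⁻¹' (U ∩ (extChartAt I x).source)
  have hP : IsOpen P := (continuousOn_extChartAt_symm x).isOpen_inter_preimage
    (isOpen_extChartAt_target x) hU'
  have hPne : P.Nonempty := ⟨extChartAt I x x, mem_extChartAt_target x, by
    simpa using hx⟩
  rw [lintegral_eq_zero_iff' (aemeasurable_volumeDensity _ g hP.measurableSet Set.inter_subset_left),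
    Filter.EventuallyEq, ae_restrict_iff' hP.measurableSet] at h1
  refine (hP.measure_pos (Module.finBasis ℝ E).addHaar hPne).ne' (measure_mono_null ?_ h1)
  intro y hy hc
  have := hc hy
  simp only [Pi.zero_apply, ENNReal.ofReal_eq_zero] at this
  exact absurd this (not_le.2 (Real.sqrt_pos.2 (det_gramMatrix_metricInChart_pos _ g hy.1)))

end Volume

/-! ### The volume of a product -/

section ProductVolume

set_option maxSynthPendingDepth 3
set_option linter.unusedSectionVars false

variable {E : Type*} [NormedAddCommGroup E] [NormedSpace ℝ E] [FiniteDimensional ℝ E]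
  [MeasurableSpace E] [BorelSpace E]
  {H : Type*} [TopologicalSpace H] {I : ModelWithCorners ℝ E H} [I.Boundaryless]
  {M : Type*} [TopologicalSpace M] [ChartedSpace H M] [IsManifold I ∞ M]
  [MeasurableSpace M] [BorelSpace M] [SecondCountableTopology M]
  {E' : Type*} [NormedAddCommGroup E'] [NormedSpace ℝ E'] [FiniteDimensional ℝ E']
  [MeasurableSpace E'] [BorelSpace E']
  {H' : Type*} [TopologicalSpace H'] {I' : ModelWithCorners ℝ E' H'} [I'.Boundaryless]
  {M' : Type*} [TopologicalSpace M'] [ChartedSpace H' M'] [IsManifold I' ∞ M']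
  [MeasurableSpace M'] [BorelSpace M'] [SecondCountableTopology M']

/-- In the basis `c.prod d` the Gram matrix is block diagonal and the density is a product, so
Tonelli applies. The volume element is first moved to that basis, as `Module.finBasis` of `E × E'`
is another one. -/
theorem chartVolume_prodMetric_apply (g : SmoothMetric I M) (h : SmoothMetric I' M') (x₀ : M × M')
    {s : Set M} {t : Set M'} (hs : MeasurableSet s) (ht : MeasurableSet t) :
    chartVolume (prodMetric g h) x₀ (s ×ˢ t) = chartVolume g x₀.1 s * chartVolume h x₀.2 t := by
  set P := (extChartAt I x₀.1).target ∩ (extChartAt I x₀.1).symm ⁻¹' s with hP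
  set Q := (extChartAt I' x₀.2).target ∩ (extChartAt I' x₀.2).symm ⁻¹' t with hQ
  have hPm : MeasurableSet P := measurableSet_target_inter x₀.1 hs
  have hQm : MeasurableSet Q := measurableSet_target_inter x₀.2 ht
  have hPQ : (extChartAt (I.prod I') x₀).target ∩ (extChartAt (I.prod I') x₀).symm ⁻¹' (s ×ˢ t) =
      P ×ˢ Q := by
    ext z
    simp only [extChartAt_prod_target, Set.mem_inter_iff, Set.mem_preimage, Set.mem_prod,
      extChartAt_prod_symm_apply, hP, hQ]
    tauto
  set c := Module.finBasis ℝ E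
  set d := Module.finBasis ℝ E'
  rw [chartVolume_apply _ _ (hs.prod ht), chartVolume_apply g _ hs, chartVolume_apply h _ ht, hPQ,
    setLIntegral_volumeDensity _ (c.prod d), Module.Basis.prod_addHaar, ← Measure.prod_restrict,
    ← lintegral_prod_mul, Measure.prod_restrict]
  · refine setLIntegral_congr_fun (hPm.prod hQm) fun z hz ↦ ?_
    rw [volumeDensity, volumeDensity, volumeDensity, ← ENNReal.ofReal_mul (Real.sqrt_nonneg _),
      ← Real.sqrt_mul]
    · have hz' : z ∈ (extChartAt I x₀.1).target ×ˢ (extChartAt I' x₀.2).target :=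
        ⟨hz.1.1, hz.2.1⟩
      have hblock : gramMatrix (c.prod d) (metricInChart (prodMetric g h) x₀ z) =
          Matrix.fromBlocks (gramMatrix c (metricInChart g x₀.1 z.1)) 0 0
            (gramMatrix d (metricInChart h x₀.2 z.2)) := by
        ext i j
        rcases i with i | i <;> rcases j with j | j <;>
          simp [gramMatrix, metricInChart_prodMetric g h x₀ hz']
      rw [hblock, Matrix.det_fromBlocks_zero₂₁]
    · exact (det_gramMatrix_metricInChart_pos _ g hz.1.1).le
  · exact aemeasurable_volumeDensity _ g hPm Set.inter_subset_left
  · exact aemeasurable_volumeDensity _ h hQm Set.inter_subset_left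

/-- The volume measure of a product is the product measure. -/
theorem riemannianVolume_prodMetric [Nonempty M] [Nonempty M'] (g : SmoothMetric I M)
    (h : SmoothMetric I' M') :
    riemannianVolume (prodMetric g h) = (riemannianVolume g).prod (riemannianVolume h) := by
  obtain ⟨x, hx⟩ := exists_seq_iUnion_source_eq_univ (I.prod I') (M × M')
  refine Measure.ext_of_iUnion_eq_univ hx fun n ↦ ?_
  rw [riemannianVolume_restrict_source, extChartAt_prod_source, ← Measure.prod_restrict,
    riemannianVolume_restrict_source, riemannianVolume_restrict_source]
  have : SigmaFinite (chartVolume g (x n).1) := by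
    rw [← riemannianVolume_restrict_source]; infer_instance
  have : SigmaFinite (chartVolume h (x n).2) := by
    rw [← riemannianVolume_restrict_source]; infer_instance
  exact (Measure.prod_eq fun s t hs ht ↦ chartVolume_prodMetric_apply g h (x n) hs ht).symm

end ProductVolume

/-! ### Joint continuity of the partial gradient norms -/

section NormSqDiff

set_option maxSynthPendingDepth 3
set_option linter.unusedSectionVars false

variable {E : Type*} [NormedAddCommGroup E] [NormedSpace ℝ E] [FiniteDimensional ℝ E]
  {H : Type*} [TopologicalSpace H] {I : ModelWithCorners ℝ E H} [I.Boundaryless]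
  {M : Type*} [TopologicalSpace M] [ChartedSpace H M] [IsManifold I ∞ M]
  {E' : Type*} [NormedAddCommGroup E'] [NormedSpace ℝ E'] [FiniteDimensional ℝ E']
  {H' : Type*} [TopologicalSpace H'] {I' : ModelWithCorners ℝ E' H'} [I'.Boundaryless]
  {M' : Type*} [TopologicalSpace M'] [ChartedSpace H' M'] [IsManifold I' ∞ M']

theorem normSqDiff_eq_zero (g : SmoothMetric I M) {u : M → ℝ} {x : M} (hu : u =ᶠ[𝓝 x] 0) :
    normSqDiff g u x = 0 := by
  have h : mvfderiv I u x = 0 := by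
    have h1 : (mvfderiv I u x : E →L[ℝ] ℝ) = mvfderiv I (0 : M → ℝ) x := hu.mfderiv_eq
    exact h1.trans mvfderiv_zero
  rw [normSqDiff, h]
  rfl

/-- The metric `2 h`. -/
def doubleMetric (h : SmoothMetric I' M') : SmoothMetric I' M' where
  inner p := h.inner p + h.inner p
  symm p v w := congrArg₂ (· + ·) (h.symm p v w) (h.symm p v w)
  pos p v hv := add_pos (h.pos p v hv) (h.pos p v hv)
  isVonNBounded p := (h.isVonNBounded p).subset fun v hv ↦ by
    have h1 : h.inner p v v + h.inner p v v < 1 := hv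
    have h2 := metric_self_nonneg h p v
    exact lt_of_le_of_lt (by linarith) h1
  contMDiff := h.contMDiff.add_section h.contMDiff

theorem normSqDiff_doubleMetric (h : SmoothMetric I' M') (u : M' → ℝ) (x : M') :
    normSqDiff (doubleMetric h) u x = normSqDiff h u x / 2 := by
  have key : ((doubleMetric h).inner x).inverse (mvfderiv I' u x) =
      (1 / 2 : ℝ) • (h.inner x).inverse (mvfderiv I' u x) := by
    refine (isInvertible_inner (doubleMetric h) x).bijective.injective ?_
    rw [(isInvertible_inner (doubleMetric h) x).self_apply_inverse]
    change _ = h.inner x _ + h.inner x _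
    rw [map_smul, (isInvertible_inner h x).self_apply_inverse, ← add_smul]
    norm_num
  rw [normSqDiff, key, map_smul, smul_eq_mul, normSqDiff]
  ring

/-- Passing from `h` to `2h` halves the `W`-part of the squared norm and fixes the `V`-part. Twice
the difference of the norms for `g + h` and `g + 2h` is therefore the `W`-part, and both norms are
continuous on the product. -/
theorem continuous_normSqDiff_right (g : SmoothMetric I M) (h : SmoothMetric I' M')
    {u : M × M' → ℝ} (hu : ContMDiff (I.prod I') 𝓘(ℝ, ℝ) ∞ u) :
    Continuous fun p : M × M' ↦ normSqDiff h (fun q ↦ u (p.1, q)) p.2 := by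
  have h1 := continuous_normSqDiff (prodMetric g h) hu
  have h2 := continuous_normSqDiff (prodMetric g (doubleMetric h)) hu
  refine ((h1.sub h2).const_smul (2 : ℝ)).congr fun p ↦ ?_
  have hp := hu.mdifferentiableAt (x := p) (by simp)
  rw [Pi.smul_apply, Pi.sub_apply, normSqDiff_prodMetric g h hp, normSqDiff_prodMetric g (doubleMetric h) hp,
    normSqDiff_doubleMetric, smul_eq_mul]
  ring

theorem continuous_normSqDiff_left (g : SmoothMetric I M) (h : SmoothMetric I' M')
    {u : M × M' → ℝ} (hu : ContMDiff (I.prod I') 𝓘(ℝ, ℝ) ∞ u) :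
    Continuous fun p : M × M' ↦ normSqDiff g (fun q ↦ u (q, p.2)) p.1 := by
  refine ((continuous_normSqDiff (prodMetric g h) hu).sub
    (continuous_normSqDiff_right g h hu)).congr fun p ↦ ?_
  rw [Pi.sub_apply, normSqDiff_prodMetric g h (hu.mdifferentiableAt (by simp))]
  ring

end NormSqDiff

/-! ### The Yamabe inequality on slices -/

section Fiber

open scoped ENNReal

set_option maxSynthPendingDepth 3

variable {E : Type*} [NormedAddCommGroup E] [NormedSpace ℝ E] [FiniteDimensional ℝ E]
  [MeasurableSpace E] [BorelSpace E]
  {H : Type*} [TopologicalSpace H] {I : ModelWithCorners ℝ E H} [I.Boundaryless]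
  {M : Type*} [TopologicalSpace M] [ChartedSpace H M] [IsManifold I ∞ M]
  [MeasurableSpace M] [BorelSpace M] [SecondCountableTopology M]

/-- The integrand of the Yamabe functional. -/
def yamabeDensity (g : SmoothMetric I M) (u : M → ℝ) (x : M) : ℝ :=
  yamabeCoeff (Module.finrank ℝ E) * normSqDiff g u x + scalarCurvature g x * u x ^ 2

theorem yamabeExp_pos {m : ℕ} (hm : 3 ≤ m) : 0 < yamabeExp m := by
  have : (3 : ℝ) ≤ m := mod_cast hm
  exact div_pos (by linarith) (by linarith)

theorem yamabeCoeff_pos {m : ℕ} (hm : 3 ≤ m) : 0 < yamabeCoeff m := by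
  have : (3 : ℝ) ≤ m := mod_cast hm
  exact div_pos (by linarith) (by linarith)

theorem integrable_abs_rpow {X : Type*} [TopologicalSpace X] [MeasurableSpace X] [BorelSpace X]
    {μ : Measure X} [IsFiniteMeasureOnCompacts μ] {u : X → ℝ} (hu : Continuous u)
    (hc : HasCompactSupport u) {p : ℝ} (hp : 0 < p) : Integrable (fun x ↦ |u x| ^ p) μ :=
  (hu.abs.rpow_const fun _ ↦ Or.inr hp.le).integrable_of_hasCompactSupport
    (hc.comp_left (g := fun t ↦ |t| ^ p) (by simp [hp.ne']))

theorem integral_abs_rpow_pos {X : Type*} [TopologicalSpace X] [MeasurableSpace X] [BorelSpace X]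
    {μ : Measure X} [IsFiniteMeasureOnCompacts μ] [μ.IsOpenPosMeasure] {u : X → ℝ}
    (hu : Continuous u) (hc : HasCompactSupport u) (h0 : u ≠ 0) {p : ℝ} (hp : 0 < p) :
    0 < ∫ x, |u x| ^ p ∂μ := by
  obtain ⟨x, hx⟩ := Function.ne_iff.1 h0
  exact (hu.abs.rpow_const fun _ ↦ Or.inr hp.le).integral_pos_of_hasCompactSupport_nonneg_nonzero
    (hc.comp_left (g := fun t ↦ |t| ^ p) (by simp [hp.ne'])) (fun _ ↦ by positivity)
    (x := x) (Real.rpow_pos_of_pos (abs_pos.2 hx) p).ne'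

theorem ofReal_integral_abs_rpow {X : Type*} [TopologicalSpace X] [MeasurableSpace X]
    [BorelSpace X] {μ : Measure X} [IsFiniteMeasureOnCompacts μ] {u : X → ℝ} (hu : Continuous u)
    (hc : HasCompactSupport u) {p : ℝ} (hp : 0 < p) :
    ENNReal.ofReal (∫ x, |u x| ^ p ∂μ) = ∫⁻ x, ‖u x‖ₑ ^ p ∂μ := by
  rw [ofReal_integral_eq_lintegral_ofReal (integrable_abs_rpow hu hc hp)
    (Filter.Eventually.of_forall fun x ↦ by positivity)]
  refine lintegral_congr fun x ↦ ?_
  rw [Real.enorm_eq_ofReal_abs, ENNReal.ofReal_rpow_of_nonneg (abs_nonneg _) hp.le]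

/-- The Yamabe inequality, for all compactly supported smooth functions. -/
theorem yamabeConstant_mul_le (g : SmoothMetric I M) (hm : 3 ≤ Module.finrank ℝ E)
    (hg : 0 ≤ yamabeConstant g) {u : M → ℝ} (hu : ContMDiff I 𝓘(ℝ, ℝ) ∞ u)
    (hc : HasCompactSupport u) :
    (yamabeConstant g).toReal * (∫ x, |u x| ^ yamabeExp (Module.finrank ℝ E) ∂riemannianVolume g) ^
        (2 / yamabeExp (Module.finrank ℝ E)) ≤
      ∫ x, yamabeDensity g u x ∂riemannianVolume g := by
  have hp := yamabeExp_pos hm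
  -- The zero function is not a test function, but slices of a test function on the product may
  -- vanish.
  rcases eq_or_ne u 0 with rfl | h0
  · have h1 (x : M) : yamabeDensity g 0 x = 0 := by
      rw [yamabeDensity, normSqDiff_eq_zero g (Filter.EventuallyEq.refl _ _)]; simp
    simp only [h1, Pi.zero_apply, abs_zero, Real.zero_rpow hp.ne', integral_zero]
    rw [Real.zero_rpow (by positivity), mul_zero]
  · have hpos := integral_abs_rpow_pos (μ := riemannianVolume g) hu.continuous hc h0 hp
    rw [← le_div_iff₀ (Real.rpow_pos_of_pos hpos _)]
    have h1 : yamabeConstant g ≤ (yamabeFunctional g u : EReal) := iInf₂_le u ⟨hu, hc, h0⟩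
    have hbot : yamabeConstant g ≠ ⊥ := fun h ↦ by simp [h] at hg
    have h2 := EReal.toReal_le_toReal h1 hbot (EReal.coe_ne_top _)
    rwa [EReal.toReal_coe] at h2

/-- The density may change sign; only its integral is controlled. This nonnegativity lets the outer
integral over slices be taken in `ℝ≥0∞`. -/
theorem integral_yamabeDensity_nonneg (g : SmoothMetric I M) (hm : 3 ≤ Module.finrank ℝ E)
    (hg : 0 ≤ yamabeConstant g) {u : M → ℝ} (hu : ContMDiff I 𝓘(ℝ, ℝ) ∞ u)
    (hc : HasCompactSupport u) : 0 ≤ ∫ x, yamabeDensity g u x ∂riemannianVolume g := by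
  refine le_trans (mul_nonneg (EReal.toReal_nonneg hg) (Real.rpow_nonneg
    (integral_nonneg fun x ↦ ?_) _)) (yamabeConstant_mul_le g hm hg hu hc)
  positivity

/-- The Yamabe inequality, integrated over a family of functions. -/
theorem yamabeConstant_mul_lintegral_le (g : SmoothMetric I M) (hm : 3 ≤ Module.finrank ℝ E)
    (hg : 0 ≤ yamabeConstant g) {X : Type*} [MeasurableSpace X] {μ : Measure X}
    {u : X → M → ℝ} (hu : ∀ y, ContMDiff I 𝓘(ℝ, ℝ) ∞ (u y)) (hc : ∀ y, HasCompactSupport (u y))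
    (hint : Integrable (fun y ↦ ∫ x, yamabeDensity g (u y) x ∂riemannianVolume g) μ) :
    ENNReal.ofReal (yamabeConstant g).toReal *
        ∫⁻ y, (∫⁻ x, ‖u y x‖ₑ ^ yamabeExp (Module.finrank ℝ E) ∂riemannianVolume g) ^
          (2 / yamabeExp (Module.finrank ℝ E)) ∂μ ≤
      ENNReal.ofReal (∫ y, ∫ x, yamabeDensity g (u y) x ∂riemannianVolume g ∂μ) := by
  have hp := yamabeExp_pos hm
  rw [ofReal_integral_eq_lintegral_ofReal hint
    (Filter.Eventually.of_forall fun y ↦ integral_yamabeDensity_nonneg g hm hg (hu y) (hc y))]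
  -- This inequality for pulling in the constant requires no measurability in `y`.
  refine (lintegral_const_mul_le _ _).trans (lintegral_mono fun y ↦ ?_)
  simp only
  rw [← ofReal_integral_abs_rpow (hu y).continuous (hc y) hp,
    ENNReal.ofReal_rpow_of_nonneg (integral_nonneg fun x ↦ by positivity) (by positivity),
    ← ENNReal.ofReal_mul (EReal.toReal_nonneg hg)]
  exact ENNReal.ofReal_le_ofReal (yamabeConstant_mul_le g hm hg (hu y) (hc y))

end Fiber

/-! ### The weighted arithmetic-geometric mean inequality -/

section RealInequality

/-- The weighted arithmetic-geometric mean step. -/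
theorem yamabe_am_gm {v w a b c κ κ' α β N₁ N₂ : ℝ} (hv : 0 < v) (hw : 0 < w) (ha : 0 < a)
    (hb : 0 < b) (hc : 0 < c) (hκ : 0 ≤ κ) (hκ' : 0 ≤ κ') (hα : 0 ≤ α) (hβ : 0 ≤ β)
    (h₁ : κ * α ≤ N₁) (h₂ : κ' * β ≤ N₂) :
    (v + w) * c / ((v * a) ^ (v / (v + w)) * (w * b) ^ (w / (v + w))) * κ ^ (v / (v + w)) *
        κ' ^ (w / (v + w)) * (α ^ (v / (v + w)) * β ^ (w / (v + w))) ≤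
      c * (N₁ / a + N₂ / b) := by
  have hm : 0 < v + w := by positivity
  set θ := v / (v + w) with hθ
  set η := w / (v + w) with hη
  have hθ0 : 0 < θ := by positivity
  have hη0 : 0 < η := by positivity
  have hsum : θ + η = 1 := by rw [hθ, hη]; field_simp
  -- The factors `(v + w)/v` and `(v + w)/w` cancel the weights in the arithmetic mean; in the
  -- geometric mean they produce the constant of the theorem.
  have amgm := Real.geom_mean_le_arith_mean2_weighted hθ0.le hη0.le
    (p₁ := (v + w) * (κ * α) / (v * a)) (p₂ := (v + w) * (κ' * β) / (w * b))
    (by positivity) (by positivity) hsum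
  have hrhs : θ * ((v + w) * (κ * α) / (v * a)) + η * ((v + w) * (κ' * β) / (w * b)) =
      κ * α / a + κ' * β / b := by
    rw [hθ, hη]; field_simp
  have hlhs : ((v + w) * (κ * α) / (v * a)) ^ θ * ((v + w) * (κ' * β) / (w * b)) ^ η =
      (v + w) / ((v * a) ^ θ * (w * b) ^ η) * κ ^ θ * κ' ^ η * (α ^ θ * β ^ η) := by
    rw [Real.div_rpow (by positivity) (by positivity), Real.div_rpow (by positivity) (by positivity),
      Real.mul_rpow hm.le (by positivity), Real.mul_rpow hm.le (by positivity),
      Real.mul_rpow hκ hα, Real.mul_rpow hκ' hβ]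
    have : (v + w) ^ θ * (v + w) ^ η = v + w := by
      rw [← Real.rpow_add hm, hsum, Real.rpow_one]
    have h3 : 0 < (v * a) ^ θ := by positivity
    have h4 : 0 < (w * b) ^ η := by positivity
    nth_rewrite 3 [← this]
    field_simp
  rw [hrhs, hlhs] at amgm
  have h5 : κ * α / a + κ' * β / b ≤ N₁ / a + N₂ / b := by gcongr
  calc _ = c * ((v + w) / ((v * a) ^ θ * (w * b) ^ η) * κ ^ θ * κ' ^ η * (α ^ θ * β ^ η)) := by
        ring
    _ ≤ _ := by
        gcongr
        exact amgm.trans h5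

end RealInequality

/-! ### The inequality for products -/

section ProductInequality

open scoped ENNReal

set_option maxSynthPendingDepth 3
set_option linter.unusedSectionVars false

/-- As `1/p_k = 1/2 - 1/k`, the weighted mean of `1/p_v` and `1/2` is `1/2 - 1/m = 1/p_m`.
Exchanging `v` and `w` gives the other condition of the interpolation. -/
theorem yamabeExp_interpolation {v w : ℕ} (hv : 3 ≤ v) (hw : 3 ≤ w) :
    (v / (v + w) : ℝ) * yamabeExp (v + w) / yamabeExp v +
      (w / (v + w) : ℝ) * yamabeExp (v + w) / 2 = 1 := by
  have h1 : (3 : ℝ) ≤ v := mod_cast hv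
  have h2 : (3 : ℝ) ≤ w := mod_cast hw
  have h3 : (v : ℝ) - 2 ≠ 0 := by linarith
  have h4 : (v : ℝ) + w - 2 ≠ 0 := by linarith
  simp only [yamabeExp, Nat.cast_add]
  field_simp
  ring

theorem two_lt_yamabeExp {m : ℕ} (hm : 3 ≤ m) : 2 < yamabeExp m := by
  have : (3 : ℝ) ≤ m := mod_cast hm
  rw [yamabeExp, lt_div_iff₀ (by linarith)]
  linarith

/-- A mixed norm of a bounded function supported in a compact set is finite. -/
theorem lintegral_lintegral_sq_rpow_ne_top {X Y : Type*} [TopologicalSpace X] [T2Space X]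
    [MeasurableSpace X] [BorelSpace X] [TopologicalSpace Y] [T2Space Y] [MeasurableSpace Y]
    [BorelSpace Y] {μ : Measure X} {ν : Measure Y} [IsFiniteMeasureOnCompacts μ]
    [IsFiniteMeasureOnCompacts ν] {u : X × Y → ℝ} (hu : Continuous u) (hc : HasCompactSupport u)
    {q : ℝ} (hq : 0 < q) :
    ∫⁻ y, (∫⁻ x, ‖u (x, y)‖ₑ ^ (2 : ℝ) ∂μ) ^ q ∂ν ≠ ⊤ := by
  obtain ⟨C, hC⟩ := hc.exists_bound_of_continuous hu
  set K₁ := Prod.fst '' tsupport u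
  set K₂ := Prod.snd '' tsupport u
  have hK₁ : IsCompact K₁ := hc.isCompact.image continuous_fst
  have hK₂ : IsCompact K₂ := hc.isCompact.image continuous_snd
  set D : ℝ≥0∞ := ENNReal.ofReal C ^ (2 : ℝ) * μ K₁
  have hD : D ≠ ⊤ := ENNReal.mul_ne_top
    (ENNReal.rpow_ne_top_of_nonneg (by norm_num) ENNReal.ofReal_ne_top) hK₁.measure_lt_top.ne
  have h0 {x : X} {y : Y} (h : x ∉ K₁ ∨ y ∉ K₂) : u (x, y) = 0 := by
    refine image_eq_zero_of_notMem_tsupport fun hxy ↦ ?_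
    rcases h with h | h
    · exact h ⟨_, hxy, rfl⟩
    · exact h ⟨_, hxy, rfl⟩
  have hle (y : Y) : (∫⁻ x, ‖u (x, y)‖ₑ ^ (2 : ℝ) ∂μ) ^ q ≤ K₂.indicator (fun _ ↦ D ^ q) y := by
    by_cases hy : y ∈ K₂
    · rw [Set.indicator_of_mem hy]
      refine ENNReal.rpow_le_rpow ?_ hq.le
      refine (lintegral_mono fun x ↦ ?_).trans
        (lintegral_indicator_const_le K₁ (ENNReal.ofReal C ^ (2 : ℝ)))
      by_cases hx : x ∈ K₁
      · rw [Set.indicator_of_mem hx]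
        refine ENNReal.rpow_le_rpow ?_ (by norm_num)
        rw [← ofReal_norm]
        exact ENNReal.ofReal_le_ofReal (hC _)
      · simp [h0 (Or.inl hx)]
    · simp [h0 (Or.inr hy), hq]
  refine ((lintegral_mono hle).trans (lintegral_indicator_const_le K₂ _)).trans_lt ?_ |>.ne
  exact ENNReal.mul_lt_top (ENNReal.rpow_lt_top_of_nonneg hq.le hD) hK₂.measure_lt_top

variable {E : Type*} [NormedAddCommGroup E] [NormedSpace ℝ E] [FiniteDimensional ℝ E]
  [MeasurableSpace E] [BorelSpace E]
  {H : Type*} [TopologicalSpace H] {I : ModelWithCorners ℝ E H} [I.Boundaryless]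
  {M : Type*} [TopologicalSpace M] [ChartedSpace H M] [IsManifold I ∞ M]
  [MeasurableSpace M] [BorelSpace M] [SecondCountableTopology M] [T2Space M]
  {E' : Type*} [NormedAddCommGroup E'] [NormedSpace ℝ E'] [FiniteDimensional ℝ E']
  [MeasurableSpace E'] [BorelSpace E']
  {H' : Type*} [TopologicalSpace H'] {I' : ModelWithCorners ℝ E' H'} [I'.Boundaryless]
  {M' : Type*} [TopologicalSpace M'] [ChartedSpace H' M'] [IsManifold I' ∞ M']
  [MeasurableSpace M'] [BorelSpace M'] [SecondCountableTopology M'] [T2Space M']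

theorem yamabeDensity_eq_zero (g : SmoothMetric I M) {u : M → ℝ} {x : M} (hu : u =ᶠ[𝓝 x] 0) :
    yamabeDensity g u x = 0 := by
  rw [yamabeDensity, normSqDiff_eq_zero g hu, hu.self_of_nhds]; simp

theorem continuous_yamabeDensity_left (g : SmoothMetric I M) (h : SmoothMetric I' M')
    {u : M × M' → ℝ} (hu : ContMDiff (I.prod I') 𝓘(ℝ, ℝ) ∞ u) :
    Continuous fun p : M × M' ↦ yamabeDensity g (fun x ↦ u (x, p.2)) p.1 :=
  (continuous_const.mul (continuous_normSqDiff_left g h hu)).add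
    (((continuous_scalarCurvature g).comp continuous_fst).mul (hu.continuous.pow 2))

theorem continuous_yamabeDensity_right (g : SmoothMetric I M) (h : SmoothMetric I' M')
    {u : M × M' → ℝ} (hu : ContMDiff (I.prod I') 𝓘(ℝ, ℝ) ∞ u) :
    Continuous fun p : M × M' ↦ yamabeDensity h (fun y ↦ u (p.1, y)) p.2 :=
  (continuous_const.mul (continuous_normSqDiff_right g h hu)).add
    (((continuous_scalarCurvature h).comp continuous_snd).mul (hu.continuous.pow 2))

theorem integrable_yamabeDensity_left (g : SmoothMetric I M) (h : SmoothMetric I' M')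
    {u : M × M' → ℝ} (hu : ContMDiff (I.prod I') 𝓘(ℝ, ℝ) ∞ u) (hc : HasCompactSupport u) :
    Integrable (fun p : M × M' ↦ yamabeDensity g (fun x ↦ u (x, p.2)) p.1)
      ((riemannianVolume g).prod (riemannianVolume h)) := by
  refine (continuous_yamabeDensity_left g h hu).integrable_of_hasCompactSupport
    (HasCompactSupport.intro hc fun p hp ↦ yamabeDensity_eq_zero g ?_)
  have h1 := notMem_tsupport_iff_eventuallyEq.1 hp
  have h2 : Filter.Tendsto (fun x ↦ (x, p.2)) (𝓝 p.1) (𝓝 p) :=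
    Continuous.tendsto (by fun_prop) _
  exact h2.eventually h1

theorem integrable_yamabeDensity_right (g : SmoothMetric I M) (h : SmoothMetric I' M')
    {u : M × M' → ℝ} (hu : ContMDiff (I.prod I') 𝓘(ℝ, ℝ) ∞ u) (hc : HasCompactSupport u) :
    Integrable (fun p : M × M' ↦ yamabeDensity h (fun y ↦ u (p.1, y)) p.2)
      ((riemannianVolume g).prod (riemannianVolume h)) := by
  refine (continuous_yamabeDensity_right g h hu).integrable_of_hasCompactSupport
    (HasCompactSupport.intro hc fun p hp ↦ yamabeDensity_eq_zero h ?_)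
  have h1 := notMem_tsupport_iff_eventuallyEq.1 hp
  have h2 : Filter.Tendsto (fun y ↦ (p.1, y)) (𝓝 p.2) (𝓝 p) :=
    Continuous.tendsto (by fun_prop) _
  exact h2.eventually h1

theorem hasCompactSupport_left {u : M × M' → ℝ} (hc : HasCompactSupport u) (y : M') :
    HasCompactSupport fun x ↦ u (x, y) :=
  HasCompactSupport.intro (hc.isCompact.image continuous_fst) fun _ hx ↦
    image_eq_zero_of_notMem_tsupport fun h ↦ hx ⟨_, h, rfl⟩

theorem hasCompactSupport_right {u : M × M' → ℝ} (hc : HasCompactSupport u) (x : M) :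
    HasCompactSupport fun y ↦ u (x, y) :=
  HasCompactSupport.intro (hc.isCompact.image continuous_snd) fun _ hy ↦
    image_eq_zero_of_notMem_tsupport fun h ↦ hy ⟨_, h, rfl⟩

/-- The pointwise lower bound of the Yamabe density of a product. -/
theorem yamabeDensity_prodMetric_ge (g : SmoothMetric I M) (h : SmoothMetric I' M')
    (hv : 3 ≤ Module.finrank ℝ E) (hw : 3 ≤ Module.finrank ℝ E') {p : M × M'}
    (hs : (scalarCurvature g p.1 + scalarCurvature h p.2) /
        yamabeCoeff (Module.finrank ℝ E + Module.finrank ℝ E') ≥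
      scalarCurvature g p.1 / yamabeCoeff (Module.finrank ℝ E) +
        scalarCurvature h p.2 / yamabeCoeff (Module.finrank ℝ E'))
    {u : M × M' → ℝ} (hu : MDifferentiableAt (I.prod I') 𝓘(ℝ, ℝ) u p) :
    yamabeCoeff (Module.finrank ℝ E + Module.finrank ℝ E') *
        (yamabeDensity g (fun x ↦ u (x, p.2)) p.1 / yamabeCoeff (Module.finrank ℝ E) +
          yamabeDensity h (fun y ↦ u (p.1, y)) p.2 / yamabeCoeff (Module.finrank ℝ E')) ≤
      yamabeDensity (prodMetric g h) u p := by
  have ha := yamabeCoeff_pos hv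
  have hb := yamabeCoeff_pos hw
  have hc := yamabeCoeff_pos (m := Module.finrank ℝ E + Module.finrank ℝ E') (by omega)
  rw [yamabeDensity, yamabeDensity, yamabeDensity, normSqDiff_prodMetric g h hu,
    scalarCurvature_prodMetric, Module.finrank_prod]
  set a := yamabeCoeff (Module.finrank ℝ E)
  set b := yamabeCoeff (Module.finrank ℝ E')
  set c := yamabeCoeff (Module.finrank ℝ E + Module.finrank ℝ E')
  have key := mul_le_mul_of_nonneg_left hs.le (mul_nonneg hc.le (sq_nonneg (u p)))
  have e1 : c * u p ^ 2 * ((scalarCurvature g p.1 + scalarCurvature h p.2) / c) =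
      (scalarCurvature g p.1 + scalarCurvature h p.2) * u p ^ 2 := by field_simp
  rw [e1] at key
  have e2 : c * ((a * normSqDiff g (fun x ↦ u (x, p.2)) p.1 + scalarCurvature g p.1 * u p ^ 2) / a
      + (b * normSqDiff h (fun y ↦ u (p.1, y)) p.2 + scalarCurvature h p.2 * u p ^ 2) / b) =
      c * (normSqDiff g (fun x ↦ u (x, p.2)) p.1 + normSqDiff h (fun y ↦ u (p.1, y)) p.2) +
        c * u p ^ 2 * (scalarCurvature g p.1 / a + scalarCurvature h p.2 / b) := by
    field_simp
    ring
  refine e2.trans_le ?_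
  linarith

/-- The constant in the lower bound for the Yamabe constant of a product. -/
def productBound (v w : ℕ) (κ κ' : ℝ) : ℝ :=
  ((v + w : ℝ) * yamabeCoeff (v + w)) /
      ((v * yamabeCoeff v) ^ (v / (v + w) : ℝ) * (w * yamabeCoeff w) ^ (w / (v + w) : ℝ)) *
    κ ^ (v / (v + w) : ℝ) * κ' ^ (w / (v + w) : ℝ)

variable [Nonempty M] [Nonempty M']

/-- The main estimate, for one test function: slicing bounds the numerator by AM-GM, and
interpolation bounds the denominator by the same product `A^θ B^η`. -/
theorem productBound_le_yamabeFunctional (g : SmoothMetric I M) (h : SmoothMetric I' M')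
    (hv : 3 ≤ Module.finrank ℝ E) (hw : 3 ≤ Module.finrank ℝ E')
    (hg : 0 ≤ yamabeConstant g) (hh : 0 ≤ yamabeConstant h)
    (hs : ∀ (x : M) (y : M'), (scalarCurvature g x + scalarCurvature h y) /
        yamabeCoeff (Module.finrank ℝ E + Module.finrank ℝ E') ≥
      scalarCurvature g x / yamabeCoeff (Module.finrank ℝ E) +
        scalarCurvature h y / yamabeCoeff (Module.finrank ℝ E'))
    {u : M × M' → ℝ} (hu : u ∈ testFunctions (I.prod I') (M × M')) :
    productBound (Module.finrank ℝ E) (Module.finrank ℝ E') (yamabeConstant g).toReal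
      (yamabeConstant h).toReal ≤ yamabeFunctional (prodMetric g h) u := by
  obtain ⟨hu, hc, h0⟩ := hu
  set μ := riemannianVolume g with hμ
  set ν := riemannianVolume h with hν
  have hG : riemannianVolume (prodMetric g h) = μ.prod ν := riemannianVolume_prodMetric g h
  have huL (y : M') : ContMDiff I 𝓘(ℝ, ℝ) ∞ fun x ↦ u (x, y) :=
    hu.comp (contMDiff_id.prodMk contMDiff_const)
  have huR (x : M) : ContMDiff I' 𝓘(ℝ, ℝ) ∞ fun y ↦ u (x, y) :=
    hu.comp (contMDiff_const.prodMk contMDiff_id)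
  have hcL (y : M') := hasCompactSupport_left hc y
  have hcR (x : M) := hasCompactSupport_right hc x
  have hiL := integrable_yamabeDensity_left g h hu hc
  have hiR := integrable_yamabeDensity_right g h hu hc
  set v := Module.finrank ℝ E with hvdef
  set w := Module.finrank ℝ E' with hwdef
  have hm : 3 ≤ v + w := by omega
  set N₁ := ∫ p, yamabeDensity g (fun x ↦ u (x, p.2)) p.1 ∂μ.prod ν with hN₁
  set N₂ := ∫ p, yamabeDensity h (fun y ↦ u (p.1, y)) p.2 ∂μ.prod ν with hN₂
  have hN₁' : N₁ = ∫ y, ∫ x, yamabeDensity g (fun x ↦ u (x, y)) x ∂μ ∂ν :=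
    integral_prod_symm _ hiL
  have hN₂' : N₂ = ∫ x, ∫ y, yamabeDensity h (fun y ↦ u (x, y)) y ∂ν ∂μ := integral_prod _ hiR
  have hN₁0 : 0 ≤ N₁ := hN₁' ▸ integral_nonneg fun y ↦
    integral_yamabeDensity_nonneg g hv hg (huL y) (hcL y)
  have hN₂0 : 0 ≤ N₂ := hN₂' ▸ integral_nonneg fun x ↦
    integral_yamabeDensity_nonneg h hw hh (huR x) (hcR x)
  have ha := yamabeCoeff_pos hv
  have hb := yamabeCoeff_pos hw
  have hcpos := yamabeCoeff_pos hm
  have hN : yamabeCoeff (v + w) * (N₁ / yamabeCoeff v + N₂ / yamabeCoeff w) ≤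
      ∫ p, yamabeDensity (prodMetric g h) u p ∂riemannianVolume (prodMetric g h) := by
    rw [hG, hN₁, hN₂, ← integral_div, ← integral_div, ← integral_add (hiL.div_const _)
      (hiR.div_const _), ← integral_const_mul]
    refine integral_mono (((hiL.div_const _).add (hiR.div_const _)).const_mul _) ?_ fun p ↦
      yamabeDensity_prodMetric_ge g h hv hw (hs p.1 p.2) (hu.mdifferentiableAt (by simp))
    refine Continuous.integrable_of_hasCompactSupport ?_
      (HasCompactSupport.intro hc fun p hp ↦ yamabeDensity_eq_zero _
        (notMem_tsupport_iff_eventuallyEq.1 hp))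
    exact (continuous_const.mul (continuous_normSqDiff (prodMetric g h) hu)).add
      ((continuous_scalarCurvature (prodMetric g h)).mul (hu.continuous.pow 2))
  have hp := yamabeExp_pos hm
  set D := ∫ p, |u p| ^ yamabeExp (v + w) ∂riemannianVolume (prodMetric g h) with hD
  have hDpos : 0 < D := integral_abs_rpow_pos hu.continuous hc h0 hp
  have hF : yamabeFunctional (prodMetric g h) u =
      (∫ p, yamabeDensity (prodMetric g h) u p ∂riemannianVolume (prodMetric g h)) /
        D ^ (2 / yamabeExp (v + w)) := by
    rw [hD, hvdef, hwdef, ← Module.finrank_prod]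
    rfl
  rw [hF, le_div_iff₀ (Real.rpow_pos_of_pos hDpos _)]
  refine le_trans ?_ hN
  set κ := (yamabeConstant g).toReal with hκ
  set κ' := (yamabeConstant h).toReal with hκ'
  have hκ0 : 0 ≤ κ := EReal.toReal_nonneg hg
  have hκ0' : 0 ≤ κ' := EReal.toReal_nonneg hh
  have hv0 : (0 : ℝ) < v := by positivity
  have hw0 : (0 : ℝ) < w := by positivity
  have hθ : (0 : ℝ) < v / (v + w) := by positivity
  have hη : (0 : ℝ) < w / (v + w) := by positivity
  -- If a factor has constant zero, the bound is zero and nonnegativity of `N₁`, `N₂` suffices.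
  -- Otherwise positivity of the constants yields the finiteness of `A` and `B` from `hA1` and
  -- `hB1`.
  rcases hκ0.eq_or_lt with hz | hκpos
  · rw [productBound, ← hz, Real.zero_rpow hθ.ne']
    simp only [mul_zero, zero_mul]
    positivity
  rcases hκ0'.eq_or_lt with hz | hκpos'
  · rw [productBound, ← hz, Real.zero_rpow hη.ne']
    simp only [mul_zero, zero_mul]
    positivity
  set A := ∫⁻ y, (∫⁻ x, ‖u (x, y)‖ₑ ^ yamabeExp v ∂μ) ^ (2 / yamabeExp v) ∂ν with hA
  set B := ∫⁻ x, (∫⁻ y, ‖u (x, y)‖ₑ ^ yamabeExp w ∂ν) ^ (2 / yamabeExp w) ∂μ with hB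
  have hA1 : ENNReal.ofReal κ * A ≤ ENNReal.ofReal N₁ := by
    rw [hN₁']
    exact yamabeConstant_mul_lintegral_le g hv hg huL hcL hiL.integral_prod_right
  have hB1 : ENNReal.ofReal κ' * B ≤ ENNReal.ofReal N₂ := by
    rw [hN₂']
    exact yamabeConstant_mul_lintegral_le h hw hh huR hcR hiR.integral_prod_left
  have hfinite {r N : ℝ} {C : ℝ≥0∞} (hr : 0 < r) (hC : ENNReal.ofReal r * C ≤ ENNReal.ofReal N) :
      C ≠ ⊤ := by
    rintro rfl
    rw [ENNReal.mul_top (by simpa using hr)] at hC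
    exact ENNReal.ofReal_ne_top (top_le_iff.1 hC)
  have hreal {r N : ℝ} {C : ℝ≥0∞} (hr : 0 < r) (hN : 0 ≤ N)
      (hC : ENNReal.ofReal r * C ≤ ENNReal.ofReal N) : r * C.toReal ≤ N := by
    have := ENNReal.toReal_mono ENNReal.ofReal_ne_top hC
    rwa [ENNReal.toReal_mul, ENNReal.toReal_ofReal hr.le, ENNReal.toReal_ofReal hN] at this
  have hη1 : 1 - (v / (v + w) : ℝ) = w / (v + w) := by field_simp; ring
  have hmix : D ^ (2 / yamabeExp (v + w)) ≤
      A.toReal ^ (v / (v + w) : ℝ) * B.toReal ^ (w / (v + w) : ℝ) := by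
    have hum : Measurable fun p : M × M' ↦ ‖u p‖ₑ := hu.continuous.measurable.enorm
    -- The second Hölder condition is the interpolation identity with the two factors exchanged.
    have h2 : (v / (v + w) : ℝ) * yamabeExp (v + w) / 2 +
        (1 - v / (v + w)) * yamabeExp (v + w) / yamabeExp w = 1 := by
      have := yamabeExp_interpolation hw hv
      rw [add_comm w v, add_comm (w : ℝ)] at this
      rw [hη1]
      linarith
    have h1 := lintegral_prod_rpow_le_mixed (μ := μ) (ν := ν) (f := fun x y ↦ ‖u (x, y)‖ₑ) hum hp
      (yamabeExp_pos hv) (two_lt_yamabeExp hw) hθ (by linarith)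
      (by rw [hη1]; exact yamabeExp_interpolation hv hw) h2
      (lintegral_lintegral_sq_rpow_ne_top hu.continuous hc
        (by linarith [two_lt_yamabeExp hw]))
    have h3 : ∫⁻ y, ∫⁻ x, ‖u (x, y)‖ₑ ^ yamabeExp (v + w) ∂μ ∂ν = ENNReal.ofReal D := by
      rw [hD, ofReal_integral_abs_rpow hu.continuous hc hp, hG]
      exact (lintegral_prod_symm _ (hum.pow_const _).aemeasurable).symm
    rw [h3, hη1, ENNReal.ofReal_rpow_of_pos hDpos] at h1
    have h4 := ENNReal.toReal_mono (ENNReal.mul_ne_top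
      (ENNReal.rpow_ne_top_of_nonneg hθ.le (hfinite hκpos hA1))
      (ENNReal.rpow_ne_top_of_nonneg hη.le (hfinite hκpos' hB1))) h1
    rwa [ENNReal.toReal_ofReal (Real.rpow_nonneg hDpos.le _), ENNReal.toReal_mul,
      ← ENNReal.toReal_rpow, ← ENNReal.toReal_rpow] at h4
  refine le_trans (mul_le_mul_of_nonneg_left hmix ?_) (yamabe_am_gm hv0 hw0 ha hb hcpos hκ0 hκ0'
    ENNReal.toReal_nonneg ENNReal.toReal_nonneg (hreal hκpos hN₁0 hA1) (hreal hκpos' hN₂0 hB1))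
  rw [productBound]
  positivity

theorem productBound_le_yamabeConstant (g : SmoothMetric I M) (h : SmoothMetric I' M')
    (hv : 3 ≤ Module.finrank ℝ E) (hw : 3 ≤ Module.finrank ℝ E')
    (hg : 0 ≤ yamabeConstant g) (hh : 0 ≤ yamabeConstant h)
    (hs : ∀ (x : M) (y : M'), (scalarCurvature g x + scalarCurvature h y) /
        yamabeCoeff (Module.finrank ℝ E + Module.finrank ℝ E') ≥
      scalarCurvature g x / yamabeCoeff (Module.finrank ℝ E) +
        scalarCurvature h y / yamabeCoeff (Module.finrank ℝ E')) :
    (productBound (Module.finrank ℝ E) (Module.finrank ℝ E') (yamabeConstant g).toReal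
      (yamabeConstant h).toReal : EReal) ≤ yamabeConstant (prodMetric g h) :=
  le_iInf₂ fun _ hu ↦ EReal.coe_le_coe_iff.2
    (productBound_le_yamabeFunctional g h hv hw hg hh hs hu)

/-- Division by `m a_m` leaves a product of powers with exponents `v/m` and `w/m`, which the `m`-th
power makes integral. This converts the bound on `μ` into the one on `ν`. -/
theorem productBound_pow {v w : ℕ} (hv : 3 ≤ v) (hw : 3 ≤ w) {κ κ' : ℝ} (hκ : 0 ≤ κ)
    (hκ' : 0 ≤ κ') :
    (productBound v w κ κ' / ((v + w : ℕ) * yamabeCoeff (v + w))) ^ (v + w) =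
      (κ / (v * yamabeCoeff v)) ^ v * (κ' / (w * yamabeCoeff w)) ^ w := by
  have ha := yamabeCoeff_pos hv
  have hb := yamabeCoeff_pos hw
  have hc := yamabeCoeff_pos (m := v + w) (by omega)
  have hv0 : (0 : ℝ) < v := by positivity
  have hw0 : (0 : ℝ) < w := by positivity
  have h1 : productBound v w κ κ' / ((v + w : ℕ) * yamabeCoeff (v + w)) =
      (κ / (v * yamabeCoeff v)) ^ (v / (v + w) : ℝ) *
        (κ' / (w * yamabeCoeff w)) ^ (w / (v + w) : ℝ) := by
    rw [productBound, Real.div_rpow hκ (by positivity), Real.div_rpow hκ' (by positivity),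
      Nat.cast_add]
    field_simp
  have hpow (x : ℝ) (hx : 0 ≤ x) (k : ℕ) : (x ^ (k / (v + w) : ℝ)) ^ (v + w) = x ^ k := by
    rw [← Real.rpow_natCast, ← Real.rpow_mul hx, Nat.cast_add,
      div_mul_cancel₀ _ (by positivity), Real.rpow_natCast]
  rw [h1, mul_pow, hpow _ (by positivity), hpow _ (by positivity)]

/-- Monotonicity of `t ↦ (t / (m a_m))^m` for `t ≥ 0`. As `toReal` sends `⊤` to `0`,
`yamabeConstant_ne_top` is essential. -/
theorem yamabeNu_prodMetric_ge (g : SmoothMetric I M) (h : SmoothMetric I' M')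
    (hv : 3 ≤ Module.finrank ℝ E) (hw : 3 ≤ Module.finrank ℝ E')
    (hg : 0 ≤ yamabeConstant g) (hh : 0 ≤ yamabeConstant h)
    (hle : (productBound (Module.finrank ℝ E) (Module.finrank ℝ E') (yamabeConstant g).toReal
      (yamabeConstant h).toReal : EReal) ≤ yamabeConstant (prodMetric g h)) :
    yamabeNu g * yamabeNu h ≤ yamabeNu (prodMetric g h) := by
  have hκ := EReal.toReal_nonneg hg
  have hκ' := EReal.toReal_nonneg hh
  have ha := yamabeCoeff_pos hv
  have hb := yamabeCoeff_pos hw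
  have hc := yamabeCoeff_pos (m := Module.finrank ℝ E + Module.finrank ℝ E') (by omega)
  have h1 := EReal.toReal_le_toReal hle (EReal.coe_ne_bot _)
    (yamabeConstant_ne_top (prodMetric g h))
  rw [EReal.toReal_coe] at h1
  rw [yamabeNu, yamabeNu, yamabeNu, Module.finrank_prod, ← productBound_pow hv hw hκ hκ']
  refine pow_le_pow_left₀ (div_nonneg ?_ (by positivity)) ?_ _
  · rw [productBound]; positivity
  · gcongr

end ProductInequality

end

end Yamabe


/-! ### The theorem for manifolds modelled on Euclidean spaces -/

open Yamabe
theorem theorem2p3 {v w : ℕ} (hv : 3 ≤ v) (hw : 3 ≤ w)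
    {V : Type*} [TopologicalSpace V] [T2Space V] [SecondCountableTopology V] [Nonempty V]
    [ChartedSpace (EuclideanSpace ℝ (Fin v)) V] [IsManifold (𝓡 v) ∞ V]
    [MeasurableSpace V] [BorelSpace V]
    {W : Type*} [TopologicalSpace W] [T2Space W] [SecondCountableTopology W] [Nonempty W]
    [ChartedSpace (EuclideanSpace ℝ (Fin w)) W] [IsManifold (𝓡 w) ∞ W]
    [MeasurableSpace W] [BorelSpace W]
    (g : SmoothMetric (𝓡 v) V) (h : SmoothMetric (𝓡 w) W)
    (hμg : 0 ≤ yamabeConstant g) (hμh : 0 ≤ yamabeConstant h)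
    (hs : ∀ (x : V) (y : W),
      (scalarCurvature g x + scalarCurvature h y) / yamabeCoeff (v + w) ≥
        scalarCurvature g x / yamabeCoeff v + scalarCurvature h y / yamabeCoeff w) :
    yamabeConstant (prodMetric g h) ≥
      ((((v + w : ℝ) * yamabeCoeff (v + w)) /
          ((v * yamabeCoeff v) ^ (v / (v + w) : ℝ) * (w * yamabeCoeff w) ^ (w / (v + w) : ℝ)) *
        (yamabeConstant g).toReal ^ (v / (v + w) : ℝ) *
        (yamabeConstant h).toReal ^ (w / (v + w) : ℝ) : ℝ) : EReal) ∧
    yamabeNu (prodMetric g h) ≥ yamabeNu g * yamabeNu h := by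
  have ev : Module.finrank ℝ (EuclideanSpace ℝ (Fin v)) = v := finrank_euclideanSpace_fin
  have ew : Module.finrank ℝ (EuclideanSpace ℝ (Fin w)) = w := finrank_euclideanSpace_fin
  have key := productBound_le_yamabeConstant g h (by rwa [ev]) (by rwa [ew]) hμg hμh
    (by rwa [ev, ew])
  refine ⟨?_, yamabeNu_prodMetric_ge g h (by rwa [ev]) (by rwa [ew]) hμg hμh key⟩
  rw [ev, ew] at key
  exact key
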